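/- **Setting.** A graph here is a finite directed graph with real edge weights $w$; when an edge is added parallel to an existing one, the lighter of the two is kept. $d(u,v)$ is the infimum of the weights of all $u\leadsto v$ walks ($+\infty$ if there is none, $-\infty$ allowed). $G_0$ is a *well-behaved* graph with vertex set $N\sqcup\bar N$, $\bar N=\{\bar r: r\in N\}$: for every $r\in N$ the edge $(r,\bar r)$ (of weight $\le 0$) is the only edge leaving $r$ and the only edge entering $\bar r$, there is an edge $(\bar r,r)$ of weight $-w(r,\bar r)$, and all edges other than the $(r,\bar r)$ have nonnegative weight. The elements of $N$ are the *negative vertices*. A *hop* is an edge of negative weight or an edge $(r,\bar r)$; $d^h(u,v)$ is the infimum over walks with at most $h$ hops. *Applying a potential* $\varphi$ replaces $w(u,v)$ by $w(u,v)+\varphi(u)-\varphi(v)$ on all edges and on all deferred edges; it is *valid* if it keeps nonnegative edges of the graph nonnegative. The cumulative potential $\Phi$ is the sum of all potentials applied so far. Besides the current graph $G$ (initially $G_0$), the algorithm keeps sets $F^{\rm in},F^{\rm out}$ of weighted *deferred* edges (initially empty) and a set of *light* vertices (initially empty; all others are heavy). Auxiliary vertices are in-Steiner vertices $x$ with in-parent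 $p^{\rm in}(x)$, out-Steiner vertices with out-parent $p^{\rm out}(x)$, and N-Steiner vertices $\tilde r_t$ with N-parent $p^{\rm N}(\tilde r_t)=r\in N$; the level of a vertex is the iteration creating it, $0$ for vertices of $G_0$. For $p\in\{p^{\rm out}(x),p^{\rm N}(x)\}$ with $p=r\in N$, $w(p,x)$ means the lighter of the edge $(r,x)$ and the path $r\to\bar r\to x$. *AddEdgeIn*$(u,v,W)$: add the edge $(u,v)$ of weight $W$. If $u$ is in-Steiner, let $p=p^{\rm in}(u)$, $W_1=W-w(u,p)$: if $v\in N$, call AddEdgeIn$(p,v,W_1)$; if $v$ is N-Steiner, put $(p,v)$ with weight $W_1$ into $F^{\rm in}$, call AddEdgeIn$(p,v,W_1)$ if $W_1\ge0$, and call AddEdgeIn$(p,p^{\rm N}(v),W-w(p^{\rm N}(v),v)-w(u,p))$. If $u$ is out-Steiner, call AddEdgeIn$(p^{\rm out}(u),v,W+w(p^{\rm out}(u),u))$. *AddEdgeOut*$(u,v,W)$: add the edge $(u,v)$ of weight $W$. If $v$ is in-Steiner, call AddEdgeOut$(u,p^{\rm in}(v),W+w(v,p^{\rm in}(v)))$.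 If $v$ is out-Steiner, let $p=p^{\rm out}(v)$, $W_1=W-w(p,v)$: if $u\in N$, call AddEdgeOut$(u,p,W_1)$; if $u$ is N-Steiner, put $(u,p)$ with weight $W_1$ into $F^{\rm out}$, call AddEdgeOut$(u,p,W_1)$ if $W_1\ge 0$, and call AddEdgeOut$(p^{\rm N}(u),p,W-w(u,p^{\rm N}(u))-w(p,v))$. *Iteration* Shortcut$(G,t)$, $t=1,2,\dots$ (loops run in arbitrary order, ties are broken arbitrarily): 1. Apply some valid potential. 2. For each $(u,v)$ of weight $W\ge 0$ that is in $F^{\rm in}$ (resp. $F^{\rm out}$) at the beginning of this step, call AddEdgeIn$(u,v,W)$ (resp. AddEdgeOut). 3. Fix reals $\Delta_r$ $(r\in N)$ and record $U^{\rm in}_r=\{v:d^0(v,r)<\Delta_r\}$, $U^{\rm out}_r=\{v:d^1(r,v)<-\Delta_r\}$ with these hop distances. 4. Record $A^{\rm in}_v$, the set of $u$ with an edge $(u,v)$ of weight $\ge0$, without in-Steiner vertices of parent $v$ if $v$ is heavy, and without $p^{\rm out}(v)$ if $v$ is out-Steiner; $A^{\rm in}_v=\emptyset$ if $v$ is in-Steiner.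 Record $A^{\rm out}_v$ symmetrically. 5. For $\bar u\in U^{\rm in}_r$ add $(u,\bar r)$ of weight $w(u,\bar u)+d^0(\bar u,r)+w(r,\bar r)$. 6. For $v\in N\cap U^{\rm out}_r$ add $(r,\bar v)$ of weight $d^1(r,v)+w(v,\bar v)$. 7. For each heavy $v$ (of step 4) with $A^{\rm in}_v=\{u_1,\dots,u_k\}\neq\emptyset$, sorted so that $w(u_1,v)\ge\dots\ge w(u_k,v)$, create for each $0\le\ell\le\lceil\log_2k\rceil-1$ an in-Steiner vertex $v_\ell$ of in-parent $v$ with: the edge $(v_\ell,v)$ of weight $w(u_{k-2^\ell},v)$; for $i\le k-2^\ell$ the edge $(u_i,v_\ell)$ of weight $w(u_i,v)-w(v_\ell,v)$ and, if $u_i$ is out-Steiner, $(p^{\rm out}(u_i),v_\ell)$ of weight $w(p^{\rm out}(u_i),u_i)+w(u_i,v)-w(v_\ell,v)$; if $v\in N$, $(v,v_\ell)$ of weight $-w(v_\ell,v)$; if $v$ is N-Steiner, $(p^{\rm N}(v),v_\ell)$ of weight $w(p^{\rm N}(v),v)-w(v_\ell,v)$. 8. For each heavy $v$ (of step 4) with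 $A^{\rm out}_v=\{u_1,\dots,u_k\}\ne\emptyset$, sorted so that $w(v,u_1)\ge\dots\ge w(v,u_k)$, create for each $0\le\ell\le\lceil\log_2k\rceil-1$ an out-Steiner vertex $v_\ell$ of out-parent $v$ with: $(v,v_\ell)$ of weight $w(v,u_{k-2^\ell})$; for $i\le k-2^\ell$ the edge $(v_\ell,u_i)$ of weight $w(v,u_i)-w(v,v_\ell)$ and, if $u_i$ is in-Steiner, $(v_\ell,p^{\rm in}(u_i))$ of weight $w(v,u_i)+w(u_i,p^{\rm in}(u_i))-w(v,v_\ell)$; if $v=\bar r$, $(v_\ell,r)$ of weight $-w(r,v)-w(v,v_\ell)$; if $v$ is N-Steiner, $(v_\ell,p^{\rm N}(v))$ of weight $w(v,p^{\rm N}(v))-w(v,v_\ell)$. 9. For each $r\in N$ create the (heavy) N-Steiner vertex $\tilde r_t$ with edges $(\tilde r_t,r)$ of weight $\Delta_r$ and $(r,\tilde r_t)$ of weight $-\Delta_r$. 10. For each $r\in N$: run ShortcutIn$(r)$, then ShortcutOut$(r)$; if $\Delta_r\le0$, call AddEdgeIn$(v,\tilde r_t,w(v,r)-\Delta_r)$ for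 all $v\in A^{\rm in}_r$; if $\Delta_r\ge-w(r,\bar r)$, call AddEdgeOut$(\tilde r_t,v,w(r,\bar r)+\Delta_r+w(\bar r,v))$ for all $v\in A^{\rm out}_{\bar r}$. 11. For each $r\in N$, let $w^{\rm out}_r$ be the least weight of an edge leaving $r$, $w^{\rm in}_r$ the minimum of $0$ and the weights of the edges entering $r$, and $W=w(r,\bar r)$; replace each edge $(r,v)$, $v\neq\bar r$, by an edge $(\bar r,v)$ of weight $w(r,v)-W$; then apply the potential that is $w^{\rm in}_r$ at $r$, $W-w^{\rm out}_r$ at $\bar r$ and $0$ elsewhere. 12. For some real $\lambda$, classify as light the in-Steiner (out-Steiner) vertices created in this iteration whose out-degree (in-degree) minus $1$ is less than $\lambda$, and the others as heavy. *ShortcutIn*$(r)$: set $d_v=d^0(v,r)$ for $v\in U^{\rm in}_r$ and $d_v=\infty$ otherwise. For $\ell=t,t-1,\dots,0$ and every level-$\ell$ vertex $v$ with $d_v<\infty$: (i) if $v$ is in-Steiner with $p=p^{\rm in}(v)$, set $d_p\leftarrow\min\{d_p,d_v-w(v,p)\}$ and nothing else. Otherwise: (ii) if $v$ is out-Steiner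 with $p=p^{\rm out}(v)$ and $W=w(p,v)+d_v-\Delta_r\ge0$, call AddEdgeIn$(p,\tilde r_t,W)$. (iii) If $v$ is heavy and $A^{\rm in}_v=\{u_1,\dots,u_k\}$ is sorted as in step 7, let $j$ be the least index with $w(u_j,v)+d_v-\Delta_r<0$ ($j=k$ if there is none) and $q=\lceil\log_2(k-j+1)\rceil$; if $q\le\lceil\log_2k\rceil-1$, call AddEdgeIn$(v_q,\tilde r_t,w(v_q,v)+d_v-\Delta_r)$; then for every $\max\{k-2^q+1,1\}\le i\le k$: if $u_i$ is a light in-Steiner vertex with $p=p^{\rm in}(u_i)$ and $W=w(u_i,v)+d_v-w(u_i,p)<\Delta_r$, set $d_p\leftarrow\min\{d_p,W\}$; if $u_i$ is not a light in-Steiner vertex and $W=w(u_i,v)+d_v-\Delta_r\ge0$, call AddEdgeIn$(u_i,\tilde r_t,W)$. (iv) If $v$ is light, then for every $u\in A^{\rm in}_v$ with $W=w(u,v)+d_v-\Delta_r\ge0$ call AddEdgeIn$(u,\tilde r_t,W)$. *ShortcutOut*$(r)$: set $d_v=d^1(r,v)$ for $v\in U^{\rm out}_r$ and $d_v=\infty$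 otherwise. For $\ell=t,\dots,0$ and every level-$\ell$ vertex $v$ with $d_v<\infty$: (i) if $v$ is out-Steiner with $p=p^{\rm out}(v)$, set $d_p\leftarrow\min\{d_p,d_v-w(p,v)\}$ and nothing else. Otherwise: (ii) if $v$ is in-Steiner with $p=p^{\rm in}(v)$ and $W=d_v+w(v,p)+\Delta_r\ge0$, call AddEdgeOut$(\tilde r_t,p,W)$. (iii) If $v$ is heavy and $A^{\rm out}_v=\{u_1,\dots,u_k\}$ is sorted as in step 8, let $j$ be the least index with $d_v+w(v,u_j)+\Delta_r<0$ ($j=k$ if there is none) and $q=\lceil\log_2(k-j+1)\rceil$; if $q\le\lceil\log_2k\rceil-1$, call AddEdgeOut$(\tilde r_t,v_q,d_v+w(v,v_q)+\Delta_r)$ with the out-Steiner vertex $v_q$ of step 8; then for every $\max\{k-2^q+1,1\}\le i\le k$: if $u_i$ is a light out-Steiner vertex with $p=p^{\rm out}(u_i)$ and $W=d_v+w(v,u_i)-w(p,u_i)<-\Delta_r$, set $d_p\leftarrow\min\{d_p,W\}$; if $u_i$ is not a light out-Steiner vertex and $W=d_v+w(v,u_i)+\Delta_r\ge0$, call AddEdgeOut$(\tilde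 r_t,u_i,W)$. (iv) If $v$ is light, then for every $u\in A^{\rm out}_v$ with $W=d_v+w(v,u)+\Delta_r\ge0$ call AddEdgeOut$(\tilde r_t,u,W)$. **Lemma.** Let $G_t$, $\Phi_t$, $F^{\rm in}_t$, $F^{\rm out}_t$ be the graph, the cumulative potential and the deferred edges after $t$ iterations, for any choices made by the algorithm. Up to the reweighting, distances between negative vertices never decrease: for all $0\le i\le j$ and $u,v\in N$, $$d_{G_j}(u,v)\;\ge\; d_{G_i}(u,v)+(\Phi_j-\Phi_i)(u)-(\Phi_j-\Phi_i)(v).$$ Moreover, let $a(r)=r,\ \psi(r)=0$ for $r\in N$; $a(\bar r)=r,\ \psi(\bar r)=-w(r,\bar r)$; $a(x)=a(p^{\rm in}(x)),\ \psi(x)=w(x,p^{\rm in}(x))+\psi(p^{\rm in}(x))$ for in-Steiner $x$; $a(x)=a(p^{\rm out}(x)),\ \psi(x)=-w(p^{\rm out}(x),x)+\psi(p^{\rm out}(x))$ for out-Steiner $x$; $a(x)=p^{\rm N}(x),\ \psi(x)=w(x,p^{\rm N}(x))$ for N-Steiner $x$, with the weights $w$ of $G_t$. Then for all $t\ge0$,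 every edge $(x,y)$ of $G_t$ and every deferred edge $(x,y)$ in $F^{\rm in}_t\cup F^{\rm out}_t$ has weight at least $d_0(a(x),a(y))+\psi(x)-\psi(y)$, where $d_0(u,v)=d_{G_0}(u,v)+\Phi_t(u)-\Phi_t(v)$ is the distance in $G_0$ under the current reweighting. -/

import Mathlib

namespace HopShortcut

/-- Vertices occurring in the shortcutting algorithm over a set `ι` of (indices of) negative
vertices. Auxiliary vertices carry the iteration `t` of their creation and their parent. -/
inductive Vert (ι : Type*) where
  /-- the original negative vertex `r ∈ N` -/
  | neg (r : ι) : Vert ι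
  /-- the original vertex `r̄ ∈ N̄` -/
  | bar (r : ι) : Vert ι
  /-- the `ℓ`-th in-Steiner vertex created in iteration `t` for its in-parent `p` -/
  | inSt (t ℓ : ℕ) (p : Vert ι) : Vert ι
  /-- the `ℓ`-th out-Steiner vertex created in iteration `t` for its out-parent `p` -/
  | outSt (t ℓ : ℕ) (p : Vert ι) : Vert ι
  /-- the N-Steiner vertex `r̃_t` created in iteration `t` for its N-parent `r` -/
  | nSt (t : ℕ) (r : ι) : Vert ι

namespace Vert

variable {ι : Type*}

/-- The iteration in which a vertex is created (`0` for original vertices). -/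
def level : Vert ι → ℕ
  | neg _ => 0
  | bar _ => 0
  | inSt t _ _ => t
  | outSt t _ _ => t
  | nSt t _ => t

/-- `x.InChild v`: `x` is an in-Steiner vertex with in-parent `v`. -/
def InChild (x v : Vert ι) : Prop := ∃ t ℓ, x = inSt t ℓ v

/-- `x.OutChild v`: `x` is an out-Steiner vertex with out-parent `v`. -/
def OutChild (x v : Vert ι) : Prop := ∃ t ℓ, x = outSt t ℓ v

def IsInSt (x : Vert ι) : Prop := ∃ v, x.InChild v

def IsOutSt (x : Vert ι) : Prop := ∃ v, x.OutChild v

/-- The ancestor of a vertex, a negative vertex. -/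
def anc : Vert ι → ι
  | neg r => r
  | bar r => r
  | inSt _ _ p => p.anc
  | outSt _ _ p => p.anc
  | nSt _ r => r

end Vert

open Vert

/-- A directed graph with real edge weights; `w u v` is meaningful only for `(u, v) ∈ E`. -/
structure WGraph (ι : Type*) where
  V : Set (Vert ι)
  E : Set (Vert ι × Vert ι)
  w : Vert ι → Vert ι → ℝ

namespace WGraph

variable {ι : Type*}

/-- Negative edges. An edge `(r, r̄)` always counts as negative, even if its weight is `0`. -/
def IsNegEdge (G : WGraph ι) (u v : Vert ι) : Prop :=
  (u, v) ∈ G.E ∧ (G.w u v < 0 ∨ ∃ r, u = neg r ∧ v = bar r)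

/-- `G.Walk h u v c`: there is a walk from `u` to `v` with exactly `h` hops (negative edges, with
multiplicity) and of total weight `c`. -/
inductive Walk (G : WGraph ι) : ℕ → Vert ι → Vert ι → ℝ → Prop
  | nil (u : Vert ι) : Walk G 0 u u 0
  | consNeg {h : ℕ} {u v x : Vert ι} {c : ℝ} :
      G.IsNegEdge u v → Walk G h v x c → Walk G (h + 1) u x (G.w u v + c)
  | consPos {h : ℕ} {u v x : Vert ι} {c : ℝ} :
      (u, v) ∈ G.E → ¬ G.IsNegEdge u v → Walk G h v x c → Walk G h u x (G.w u v + c)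

/-- The distance `d(u, v)`: `⊤` if `v` is not reachable from `u`, `⊥` if there are walks of
arbitrarily negative weight. -/
noncomputable def dist (G : WGraph ι) (u v : Vert ι) : EReal :=
  sInf ((fun c : ℝ => (c : EReal)) '' {c | ∃ h, G.Walk h u v c})

/-- The `k`-hop distance `d^k(u, v)`: only walks with at most `k` hops are allowed. -/
noncomputable def hopDist (G : WGraph ι) (k : ℕ) (u v : Vert ι) : EReal :=
  sInf ((fun c : ℝ => (c : EReal)) '' {c | ∃ h, h ≤ k ∧ G.Walk h u v c})

/-- A well-behaved graph with vertex set `N ∪ N̄`: the negative edges are the edges `(r, r̄)`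
(of weight `≤ 0`), each of them is the only edge out of `r` and the only edge into `r̄`, and there
is a reverse edge `(r̄, r)` of the opposite weight. -/
structure WellBehaved (G : WGraph ι) : Prop where
  verts : G.V = Set.range neg ∪ Set.range bar
  edge_mem : ∀ u v, (u, v) ∈ G.E → u ∈ G.V ∧ v ∈ G.V
  neg_edge : ∀ r, (neg r, bar r) ∈ G.E
  neg_edge_le : ∀ r, G.w (neg r) (bar r) ≤ 0
  neg_out : ∀ r v, (neg r, v) ∈ G.E → v = bar r
  bar_in : ∀ r v, (v, bar r) ∈ G.E → v = neg r
  rev_edge : ∀ r, (bar r, neg r) ∈ G.E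
  rev_weight : ∀ r, G.w (bar r) (neg r) = - G.w (neg r) (bar r)
  nonneg : ∀ u v, (u, v) ∈ G.E → (¬ ∃ r, u = neg r ∧ v = bar r) → 0 ≤ G.w u v

/-- A vertex potential is valid if it keeps nonnegative edges nonnegative. -/
def ValidPotential (G : WGraph ι) (φ : Vert ι → ℝ) : Prop :=
  ∀ u v, (u, v) ∈ G.E → 0 ≤ G.w u v → 0 ≤ G.w u v + φ u - φ v

end WGraph

/-- The state of the algorithm: the current graph, the deferred edges `F^in`, `F^out`
(with their current weights), the set of light vertices, and the cumulative vertex potential,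
i.e. the sum of all vertex potentials that have been applied so far. -/
structure State (ι : Type*) extends WGraph ι where
  defIn : Set (Vert ι × Vert ι × ℝ)
  defOut : Set (Vert ι × Vert ι × ℝ)
  light : Set (Vert ι)
  pot : Vert ι → ℝ

namespace State

variable {ι : Type*}

/-- The initial state: all vertices are heavy and no edge is deferred. -/
def init (G : WGraph ι) : State ι :=
  { G with defIn := ∅, defOut := ∅, light := ∅, pot := fun _ => 0 }

/-- A vertex of the graph is heavy if it has not been classified as light. -/
def Heavy (s : State ι) (v : Vert ι) : Prop := v ∈ s.V ∧ v ∉ s.light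

/-- Apply a vertex potential to the whole graph and to the deferred edges. -/
def reweight (s : State ι) (φ : Vert ι → ℝ) : State ι :=
  { s with
    w := fun u v => s.w u v + φ u - φ v
    defIn := (fun e => (e.1, e.2.1, e.2.2 + φ e.1 - φ e.2.1)) '' s.defIn
    defOut := (fun e => (e.1, e.2.1, e.2.2 + φ e.1 - φ e.2.1)) '' s.defOut
    pot := fun v => s.pot v + φ v }

def addVertex (s : State ι) (v : Vert ι) : State ι := { s with V := insert v s.V }

open Classical in
/-- Add an edge `(u, v)` of weight `W`; of two parallel edges only the lighter one is kept. -/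
noncomputable def addEdge (s : State ι) (u v : Vert ι) (W : ℝ) : State ι :=
  { s with
    E := insert (u, v) s.E
    w := fun x y =>
      if x = u ∧ y = v then (if (u, v) ∈ s.E then min (s.w u v) W else W) else s.w x y }

def deferIn (s : State ι) (u v : Vert ι) (W : ℝ) : State ι :=
  { s with defIn := insert (u, v, W) s.defIn }

def deferOut (s : State ι) (u v : Vert ι) (W : ℝ) : State ι :=
  { s with defOut := insert (u, v, W) s.defOut }

open Classical in
/-- The weight of the connection from a vertex `u` to its child `v`. It is the weight of the edge
`(u, v)`, except that at the end of each iteration an edge `(r, v)` leaving a negative vertex `r`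
is replaced by the path `r → r̄ → v` of the same weight, which is still read as an edge `(r, v)`
(if a parallel edge `(r, v)` is present as well, the lighter of the two counts). -/
noncomputable def childW (s : State ι) (u v : Vert ι) : ℝ :=
  match u with
  | neg r =>
      if (neg r, v) ∈ s.E then
        if (bar r, v) ∈ s.E then
          min (s.w (neg r) v) (s.w (neg r) (bar r) + s.w (bar r) v)
        else s.w (neg r) v
      else s.w (neg r) (bar r) + s.w (bar r) v
  | u => s.w u v

/-- The procedure `AddEdgeIn(u, v, W)`. -/
noncomputable def addEdgeIn : Vert ι → Vert ι → ℝ → State ι → State ι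
  | inSt a ℓ p, v, W, s =>
      let s₁ := s.addEdge (inSt a ℓ p) v W
      let W₁ := W - s₁.w (inSt a ℓ p) p
      match v with
      | neg _ => addEdgeIn p v W₁ s₁
      | nSt _ r =>
          let s₂ := s₁.deferIn p v W₁
          let s₃ := if 0 ≤ W₁ then addEdgeIn p v W₁ s₂ else s₂
          addEdgeIn p (neg r) (W - s₃.childW (neg r) v - s₃.w (inSt a ℓ p) p) s₃
      | _ => s₁
  | outSt a ℓ p, v, W, s =>
      let s₁ := s.addEdge (outSt a ℓ p) v W
      addEdgeIn p v (W + s₁.childW p (outSt a ℓ p)) s₁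
  | u, v, W, s => s.addEdge u v W

/-- The procedure `AddEdgeOut(u, v, W)`, with the arguments in the order `v u W`. -/
noncomputable def addEdgeOut : Vert ι → Vert ι → ℝ → State ι → State ι
  | inSt a ℓ p, u, W, s =>
      let s₁ := s.addEdge u (inSt a ℓ p) W
      addEdgeOut p u (W + s₁.w (inSt a ℓ p) p) s₁
  | outSt a ℓ p, u, W, s =>
      let s₁ := s.addEdge u (outSt a ℓ p) W
      let W₁ := W - s₁.childW p (outSt a ℓ p)
      match u with
      | neg _ => addEdgeOut p u W₁ s₁
      | nSt _ r =>
          let s₂ := s₁.deferOut u p W₁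
          let s₃ := if 0 ≤ W₁ then addEdgeOut p u W₁ s₂ else s₂
          addEdgeOut p (neg r) (W - s₃.w u (neg r) - s₃.childW p (outSt a ℓ p)) s₃
      | _ => s₁
  | v, u, W, s => s.addEdge u v W

/-- The frozen list `A^in_v` of in-neighbours of `v` along nonnegative edges. -/
def listIn (s : State ι) (v : Vert ι) : Set (Vert ι) :=
  {u | (u, v) ∈ s.E ∧ 0 ≤ s.w u v ∧ ¬ v.IsInSt ∧ ¬ (s.Heavy v ∧ u.InChild v) ∧ ¬ v.OutChild u}

/-- The frozen list `A^out_v` of out-neighbours of `v` along nonnegative edges. -/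
def listOut (s : State ι) (v : Vert ι) : Set (Vert ι) :=
  {u | (v, u) ∈ s.E ∧ 0 ≤ s.w v u ∧ ¬ v.IsOutSt ∧ ¬ (s.Heavy v ∧ u.OutChild v) ∧ ¬ v.InChild u}

/-- Given the sorted list `l = [u₁, …, u_k]` of `A^in_v`, create the `ℓ`-th in-Steiner vertex of
`v` in iteration `t`, with its edges. -/
noncomputable def addInSteiner (t : ℕ) (v : Vert ι) (l : List (Vert ι)) (ℓ : ℕ) (s : State ι) :
    State ι :=
  let x := inSt t ℓ v
  let s₁ := (s.addVertex x).addEdge x v (s.w (l.getD (l.length - 2 ^ ℓ - 1) v) v)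
  let s₂ := (l.take (l.length - 2 ^ ℓ)).foldl (fun s u =>
    let s' := s.addEdge u x (s.w u v - s.w x v)
    match u with
    | outSt _ _ p => s'.addEdge p x (s'.childW p u + s'.w u v - s'.w x v)
    | _ => s') s₁
  match v with
  | neg _ => s₂.addEdge v x (- s₂.w x v)
  | nSt _ r => s₂.addEdge (neg r) x (s₂.childW (neg r) v - s₂.w x v)
  | _ => s₂

/-- Given the sorted list `l = [u₁, …, u_k]` of `A^out_v`, create the `ℓ`-th out-Steiner vertex of
`v` in iteration `t`, with its edges. -/
noncomputable def addOutSteiner (t : ℕ) (v : Vert ι) (l : List (Vert ι)) (ℓ : ℕ) (s : State ι) :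
    State ι :=
  let x := outSt t ℓ v
  let s₁ := (s.addVertex x).addEdge v x (s.w v (l.getD (l.length - 2 ^ ℓ - 1) v))
  let s₂ := (l.take (l.length - 2 ^ ℓ)).foldl (fun s u =>
    let s' := s.addEdge x u (s.w v u - s.w v x)
    match u with
    | inSt _ _ p => s'.addEdge x p (s'.w v u + s'.w u p - s'.w v x)
    | _ => s') s₁
  match v with
  | bar r => s₂.addEdge x (neg r) (- s₂.w (neg r) v - s₂.w v x)
  | nSt _ r => s₂.addEdge x (neg r) (s₂.w v (neg r) - s₂.w v x)
  | _ => s₂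

/-- Create all in-Steiner vertices `v_0, …, v_τ` of `v`, where `τ = ⌈log₂ k⌉ - 1`. -/
noncomputable def addInGadget (t : ℕ) (v : Vert ι) (l : List (Vert ι)) (s : State ι) : State ι :=
  (List.range (Nat.clog 2 l.length)).foldl (fun s ℓ => addInSteiner t v l ℓ s) s

/-- Create all out-Steiner vertices `v_0, …, v_τ` of `v`, where `τ = ⌈log₂ k⌉ - 1`. -/
noncomputable def addOutGadget (t : ℕ) (v : Vert ι) (l : List (Vert ι)) (s : State ι) : State ι :=
  (List.range (Nat.clog 2 l.length)).foldl (fun s ℓ => addOutSteiner t v l ℓ s) s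

/-- Create the N-Steiner vertex `r̃_t`, with its edges from and to `r`. -/
noncomputable def addNSteiner (t : ℕ) (Δ : ι → ℝ) (r : ι) (s : State ι) : State ι :=
  ((s.addVertex (nSt t r)).addEdge (nSt t r) (neg r) (Δ r)).addEdge (neg r) (nSt t r) (- Δ r)

open Classical in
/-- Replace every edge `(r, v)` with `v ≠ r̄` by an edge `(r̄, v)` of weight `w(r, v) - w(r, r̄)`,
that is, by the path `r → r̄ → v` of the same weight. -/
noncomputable def redirect (r : ι) (s : State ι) : State ι :=
  { s with
    E := {e | e ∈ s.E ∧ (e.1 = neg r → e.2 = bar r)} ∪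
      {e | e.1 = bar r ∧ e.2 ≠ bar r ∧ (neg r, e.2) ∈ s.E}
    w := fun x y =>
      if x = bar r ∧ y ≠ bar r ∧ (neg r, y) ∈ s.E then
        (if (bar r, y) ∈ s.E then min (s.w (bar r) y) (s.w (neg r) y - s.w (neg r) (bar r))
          else s.w (neg r) y - s.w (neg r) (bar r))
      else s.w x y }

open Classical in
/-- Restore well-behavedness at `r`: redirect the edges leaving `r` to `r̄`, then apply the vertex
potential `r ↦ w^in_r`, `r̄ ↦ w(r, r̄) - w^out_r` (and `0` elsewhere). -/
noncomputable def restore (r : ι) (s : State ι) : State ι :=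
  let W := s.w (neg r) (bar r)
  let wOut := sInf {c | ∃ v, (neg r, v) ∈ s.E ∧ c = s.w (neg r) v}
  let wIn := min 0 (sInf {c | ∃ v, (v, neg r) ∈ s.E ∧ c = s.w v (neg r)})
  (s.redirect r).reweight
    (fun x => if x = neg r then wIn else if x = bar r then W - wOut else 0)

/-- Classify the Steiner vertices of iteration `t` as light or heavy, with threshold `lam`. -/
noncomputable def classify (t : ℕ) (lam : ℝ) (s : State ι) : State ι :=
  { s with
    light := s.light ∪
      {x | x ∈ s.V ∧ x.IsInSt ∧ x.level = t ∧ (({u | (x, u) ∈ s.E}.ncard : ℝ) - 1 < lam)} ∪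
      {x | x ∈ s.V ∧ x.IsOutSt ∧ x.level = t ∧ (({u | (u, x) ∈ s.E}.ncard : ℝ) - 1 < lam)} }

/-- The potential `ψ` of a vertex. -/
noncomputable def psi (s : State ι) : Vert ι → ℝ
  | neg _ => 0
  | bar r => - s.w (neg r) (bar r)
  | inSt t ℓ p => s.w (inSt t ℓ p) p + psi s p
  | outSt t ℓ p => - s.childW p (outSt t ℓ p) + psi s p
  | nSt t r => s.w (nSt t r) (neg r)

end State

/-- Execute `step` successively for the members of a list. -/
inductive RunList {σ β : Type*} (step : β → σ → σ → Prop) : List β → σ → σ → Prop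
  | nil (s : σ) : RunList step [] s s
  | cons {b : β} {l : List β} {s s' s'' : σ} :
      step b s s' → RunList step l s' s'' → RunList step (b :: l) s s''

/-- The loop "for every `b ∈ S` do `step b`", in an arbitrary order. -/
def ForEach {σ β : Type*} (S : Set β) (step : β → σ → σ → Prop) (s s' : σ) : Prop :=
  ∃ l : List β, l.Nodup ∧ (∀ b, b ∈ l ↔ b ∈ S) ∧ RunList step l s s'

variable {ι : Type*}

/-- `l` lists the elements of `A` in nonincreasing order of `f`. -/
def SortedEnum (A : Set (Vert ι)) (f : Vert ι → ℝ) (l : List (Vert ι)) : Prop :=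
  l.Nodup ∧ (∀ u, u ∈ l ↔ u ∈ A) ∧ l.Pairwise (fun a b => f b ≤ f a)

open Classical in
/-- The update `d_p ← min (d_p) W` of tentative distances. -/
noncomputable def relax (d : Vert ι → WithTop ℝ) (p : Vert ι) (W : ℝ) : Vert ι → WithTop ℝ :=
  Function.update d p (min (d p) (W : WithTop ℝ))

/-- What `ShortcutIn(r, t)` does at an out-Steiner vertex `v` with `d_v = x`. -/
noncomputable def scInOut (t : ℕ) (r : ι) (δ : ℝ) (v : Vert ι) (x : ℝ) (s : State ι) : State ι :=
  match v with
  | outSt _ _ p =>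
      if 0 ≤ s.childW p v + x - δ then
        State.addEdgeIn p (nSt t r) (s.childW p v + x - δ) s
      else s
  | _ => s

open Classical in
/-- The treatment in `ShortcutIn(r, t)` of one in-neighbour `u` of a vertex `v` with `d_v = x`:
add an edge from `u` to the hub, or, if `u` is a light in-Steiner vertex, pass on to its parent. -/
noncomputable def scInScan (t : ℕ) (r : ι) (δ : ℝ) (v : Vert ι) (x : ℝ)
    (c : State ι × (Vert ι → WithTop ℝ)) (u : Vert ι) : State ι × (Vert ι → WithTop ℝ) :=
  let other :=
    if 0 ≤ c.1.w u v + x - δ then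
      (State.addEdgeIn u (nSt t r) (c.1.w u v + x - δ) c.1, c.2)
    else c
  match u with
  | inSt _ _ p =>
      if u ∈ c.1.light then
        if c.1.w u v + x - c.1.w u p < δ then (c.1, relax c.2 p (c.1.w u v + x - c.1.w u p)) else c
      else other
  | _ => other

open Classical in
/-- What `ShortcutIn(r, t)` does at a heavy vertex `v` with `d_v = x`, where `l = [u₁, …, u_k]` is
the sorted list of `A^in_v`; the index `j` starts from `0`. -/
noncomputable def scInHeavy (t : ℕ) (r : ι) (δ : ℝ) (l : List (Vert ι)) (v : Vert ι) (x : ℝ)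
    (c : State ι × (Vert ι → WithTop ℝ)) : State ι × (Vert ι → WithTop ℝ) :=
  let k := l.length
  let j := min (l.findIdx (fun u => decide (c.1.w u v + x - δ < 0))) (k - 1)
  let ℓ := Nat.clog 2 (k - j)
  let s₁ := if ℓ < Nat.clog 2 k then
      State.addEdgeIn (inSt t ℓ v) (nSt t r) (c.1.w (inSt t ℓ v) v + x - δ) c.1
    else c.1
  (l.drop (k - 2 ^ ℓ)).foldl (scInScan t r δ v x) (s₁, c.2)

/-- Processing of one vertex `v` in `ShortcutIn(r, t)`. -/
def scInProcess (t : ℕ) (r : ι) (δ : ℝ) (A : Vert ι → Set (Vert ι)) (L : Vert ι → List (Vert ι))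
    (v : Vert ι) (c c' : State ι × (Vert ι → WithTop ℝ)) : Prop :=
  ∃ x : ℝ, c.2 v = (x : WithTop ℝ) ∧
    ((∃ p, v.InChild p ∧ c' = (c.1, relax c.2 p (x - c.1.w v p))) ∨
     (¬ v.IsInSt ∧ v ∉ c.1.light ∧
        c' = scInHeavy t r δ (L v) v x (scInOut t r δ v x c.1, c.2)) ∨
     (¬ v.IsInSt ∧ v ∈ c.1.light ∧ c'.2 = c.2 ∧
        ForEach (A v) (fun u s s' =>
          s' = if 0 ≤ s.w u v + x - δ then State.addEdgeIn u (nSt t r) (s.w u v + x - δ) s else s)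
          (scInOut t r δ v x c.1) c'.1))

/-- The procedure `ShortcutIn(r, t)`, for the threshold `δ = Δ_r`, the frozen lists `A` (sorted: `L`)
and the initial tentative distances `d` (`d_v = d⁰(v, r)` for `v ∈ U^in_r`, and `∞` otherwise).
The vertices of level `ℓ` with finite `d_v` form the set `S_ℓ`. -/
def ShortcutIn (t : ℕ) (r : ι) (δ : ℝ) (A : Vert ι → Set (Vert ι)) (L : Vert ι → List (Vert ι))
    (d : Vert ι → WithTop ℝ) (s s' : State ι) : Prop :=
  ∃ d', RunList (fun ℓ c c' =>
      ForEach {v | v ∈ c.1.V ∧ v.level = ℓ ∧ c.2 v ≠ ⊤} (scInProcess t r δ A L) c c')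
    (List.range (t + 1)).reverse (s, d) (s', d')

/-- What `ShortcutOut(r, t)` does at an in-Steiner vertex `v` with `d_v = x`. -/
noncomputable def scOutIn (t : ℕ) (r : ι) (δ : ℝ) (v : Vert ι) (x : ℝ) (s : State ι) : State ι :=
  match v with
  | inSt _ _ p =>
      if 0 ≤ x + s.w v p + δ then State.addEdgeOut p (nSt t r) (x + s.w v p + δ) s else s
  | _ => s

open Classical in
/-- The treatment in `ShortcutOut(r, t)` of one out-neighbour `u` of a vertex `v` with `d_v = x`:
add an edge from the hub to `u`, or, if `u` is a light out-Steiner vertex, pass on to its parent. -/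
noncomputable def scOutScan (t : ℕ) (r : ι) (δ : ℝ) (v : Vert ι) (x : ℝ)
    (c : State ι × (Vert ι → WithTop ℝ)) (u : Vert ι) : State ι × (Vert ι → WithTop ℝ) :=
  let other :=
    if 0 ≤ x + c.1.w v u + δ then
      (State.addEdgeOut u (nSt t r) (x + c.1.w v u + δ) c.1, c.2)
    else c
  match u with
  | outSt _ _ p =>
      if u ∈ c.1.light then
        if x + c.1.w v u - c.1.childW p u < - δ then
          (c.1, relax c.2 p (x + c.1.w v u - c.1.childW p u))
        else c
      else other
  | _ => other

open Classical in
/-- What `ShortcutOut(r, t)` does at a heavy vertex `v` with `d_v = x`, where `l = [u₁, …, u_k]` is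
the sorted list of `A^out_v`; the index `j` starts from `0`. -/
noncomputable def scOutHeavy (t : ℕ) (r : ι) (δ : ℝ) (l : List (Vert ι)) (v : Vert ι) (x : ℝ)
    (c : State ι × (Vert ι → WithTop ℝ)) : State ι × (Vert ι → WithTop ℝ) :=
  let k := l.length
  let j := min (l.findIdx (fun u => decide (x + c.1.w v u + δ < 0))) (k - 1)
  let ℓ := Nat.clog 2 (k - j)
  let s₁ := if ℓ < Nat.clog 2 k then
      State.addEdgeOut (outSt t ℓ v) (nSt t r) (x + c.1.childW v (outSt t ℓ v) + δ) c.1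
    else c.1
  (l.drop (k - 2 ^ ℓ)).foldl (scOutScan t r δ v x) (s₁, c.2)

/-- Processing of one vertex `v` in `ShortcutOut(r, t)`. -/
def scOutProcess (t : ℕ) (r : ι) (δ : ℝ) (A : Vert ι → Set (Vert ι)) (L : Vert ι → List (Vert ι))
    (v : Vert ι) (c c' : State ι × (Vert ι → WithTop ℝ)) : Prop :=
  ∃ x : ℝ, c.2 v = (x : WithTop ℝ) ∧
    ((∃ p, v.OutChild p ∧ c' = (c.1, relax c.2 p (x - c.1.childW p v))) ∨
     (¬ v.IsOutSt ∧ v ∉ c.1.light ∧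
        c' = scOutHeavy t r δ (L v) v x (scOutIn t r δ v x c.1, c.2)) ∨
     (¬ v.IsOutSt ∧ v ∈ c.1.light ∧ c'.2 = c.2 ∧
        ForEach (A v) (fun u s s' =>
          s' = if 0 ≤ x + s.w v u + δ then State.addEdgeOut u (nSt t r) (x + s.w v u + δ) s else s)
          (scOutIn t r δ v x c.1) c'.1))

/-- The procedure `ShortcutOut(r, t)`, for the threshold `δ = Δ_r`, the frozen lists `A` (sorted:
`L`) and the initial tentative distances `d` (`d_v = d¹(r, v)` for `v ∈ U^out_r`, and `∞`
otherwise). -/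
def ShortcutOut (t : ℕ) (r : ι) (δ : ℝ) (A : Vert ι → Set (Vert ι)) (L : Vert ι → List (Vert ι))
    (d : Vert ι → WithTop ℝ) (s s' : State ι) : Prop :=
  ∃ d', RunList (fun ℓ c c' =>
      ForEach {v | v ∈ c.1.V ∧ v.level = ℓ ∧ c.2 v ≠ ⊤} (scOutProcess t r δ A L) c c')
    (List.range (t + 1)).reverse (s, d) (s', d')

/-- The set `U^in_r = {v : d⁰(v, r) < Δ_r}`. -/
def setUIn (s : State ι) (Δ : ι → ℝ) (r : ι) : Set (Vert ι) :=
  {v | v ∈ s.V ∧ s.hopDist 0 v (neg r) < (Δ r : EReal)}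

/-- The set `U^out_r = {v : d¹(r, v) < -Δ_r}`. -/
def setUOut (s : State ι) (Δ : ι → ℝ) (r : ι) : Set (Vert ι) :=
  {v | v ∈ s.V ∧ s.hopDist 1 (neg r) v < ((- Δ r : ℝ) : EReal)}

open Classical in
/-- The function that is `f` on `U` and `∞` elsewhere. -/
noncomputable def restrictTop (U : Set (Vert ι)) (f : Vert ι → ℝ) : Vert ι → WithTop ℝ :=
  fun v => if v ∈ U then (f v : WithTop ℝ) else ⊤

/-- Shortcut generation around one negative vertex `r`. The lists `Ain`, `Aout` are the frozen
lists `A^in`, `A^out`, and `Lin`, `Lout` are their sorted enumerations. -/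
def ShortcutAt (t : ℕ) (Δ : ι → ℝ) (Ain Aout : Vert ι → Set (Vert ι))
    (Lin Lout : Vert ι → List (Vert ι)) (din dout : ι → Vert ι → WithTop ℝ)
    (r : ι) (s s' : State ι) : Prop :=
  ∃ s₁ s₂ s₃ : State ι,
    ShortcutIn t r (Δ r) Ain Lin (din r) s s₁ ∧
    ShortcutOut t r (Δ r) Aout Lout (dout r) s₁ s₂ ∧
    (if Δ r ≤ 0 then
        ForEach (Ain (neg r)) (fun v σ σ' =>
          σ' = State.addEdgeIn v (nSt t r) (σ.w v (neg r) - Δ r) σ) s₂ s₃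
      else s₃ = s₂) ∧
    (if - s₃.w (neg r) (bar r) ≤ Δ r then
        ForEach (Aout (bar r)) (fun v σ σ' =>
          σ' = State.addEdgeOut v (nSt t r)
            (σ.w (neg r) (bar r) + Δ r + σ.w (bar r) v) σ) s₃ s'
      else s' = s₃)

/-- One iteration `Shortcut(G, t)`: `Shortcut t s s'` says that the iteration, started in the
state `s`, may end in the state `s'`. The choices left open by the algorithm (or made by its
subroutines) are arbitrary: the valid vertex potential `φ` returned by betweenness reduction, the
thresholds `Δ`, the degree threshold `lam`, the ordering of ties, and the order of all loops. -/
inductive Shortcut (t : ℕ) (s : State ι) : State ι → Prop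
  | run (φ : Vert ι → ℝ) (Δ : ι → ℝ) (lam : ℝ) (dIn dOut : ι → Vert ι → ℝ)
      (Lin Lout : Vert ι → List (Vert ι))
      (s₁ s₂ s₃ s₄ s₅ s₆ s₇ s₈ s₉ s₁₀ s₁₁ : State ι)
      -- Reweighting by a valid potential.
      (reweight_valid : s.ValidPotential φ)
      (reweight_eq : s₁ = s.reweight φ)
      -- Insertion of the deferred edges that have become nonnegative.
      (deferred_in : ForEach s₁.defIn (fun e σ σ' =>
        σ' = if 0 ≤ e.2.2 then State.addEdgeIn e.1 e.2.1 e.2.2 σ else σ) s₁ s₂)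
      (deferred_out : ForEach s₁.defOut (fun e σ σ' =>
        σ' = if 0 ≤ e.2.2 then State.addEdgeOut e.2.1 e.1 e.2.2 σ else σ) s₂ s₃)
      -- Computation of the distances `d⁰(v, r)` on `U^in_r` and `d¹(r, v)` on `U^out_r`.
      (dist_in : ∀ r, ∀ v ∈ setUIn s₃ Δ r, (dIn r v : EReal) = s₃.hopDist 0 v (neg r))
      (dist_out : ∀ r, ∀ v ∈ setUOut s₃ Δ r, (dOut r v : EReal) = s₃.hopDist 1 (neg r) v)
      -- Simple shortcutting: merge `(r, r̄)` with a preceding or succeeding negative edge.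
      (merge_left : ForEach {q : ι × ι | bar q.2 ∈ setUIn s₃ Δ q.1} (fun q σ σ' =>
        σ' = σ.addEdge (neg q.2) (bar q.1)
          (σ.w (neg q.2) (bar q.2) + dIn q.1 (bar q.2) + σ.w (neg q.1) (bar q.1))) s₃ s₄)
      (merge_right : ForEach {q : ι × ι | neg q.2 ∈ setUOut s₃ Δ q.1} (fun q σ σ' =>
        σ' = σ.addEdge (neg q.1) (bar q.2)
          (dOut q.1 (neg q.2) + σ.w (neg q.2) (bar q.2))) s₄ s₅)
      -- Creation of the in-Steiner and out-Steiner gadgets of all heavy vertices.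
      (sorted_in : ∀ v, s₃.Heavy v → SortedEnum (s₃.listIn v) (fun u => s₅.w u v) (Lin v))
      (gadgets_in : ForEach {v | s₃.Heavy v} (fun v σ σ' =>
        σ' = σ.addInGadget t v (Lin v)) s₅ s₆)
      (sorted_out : ∀ v, s₃.Heavy v → SortedEnum (s₃.listOut v) (fun u => s₆.w v u) (Lout v))
      (gadgets_out : ForEach {v | s₃.Heavy v} (fun v σ σ' =>
        σ' = σ.addOutGadget t v (Lout v)) s₆ s₇)
      -- Creation of the N-Steiner vertices.
      (hubs : ForEach Set.univ (fun r σ σ' => σ' = σ.addNSteiner t Δ r) s₇ s₈)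
      -- Generation of the shortcut edges.
      (shortcuts : ForEach Set.univ (ShortcutAt t Δ s₃.listIn s₃.listOut Lin Lout
        (fun r => restrictTop (setUIn s₃ Δ r) (dIn r))
        (fun r => restrictTop (setUOut s₃ Δ r) (dOut r))) s₈ s₉)
      -- Restoring well-behavedness, and classification of the new Steiner vertices.
      (restored : ForEach Set.univ (fun r σ σ' => σ' = σ.restore r) s₉ s₁₀)
      (classified : s₁₁ = s₁₀.classify t lam) :
      Shortcut t s s₁₁

end HopShortcut

/-! Every vertex `x` is regarded as a shifted copy of its ancestor `a(x)`. The invariant `Inv`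
provides a real function `θ` on the vertices such that each edge or deferred edge `(x, y)` of weight
`W` satisfies `d_{G₀}(a(x), a(y)) ≤ W - θ x + θ y`; this is the predicate `Admits`. The predicate is
additive along walks (`Admits.trans`), monotone in `W`, and does not mention the current state. A
weight once admitted therefore stays admitted while other edges are added.

Each weight computed by the algorithm is a sum of weights of present edges, hop distances, and
negated weights of links between a vertex and its parent. Only the negated terms are delicate, since
a link may have become lighter since its creation. The invariant also records that a link from `x`
to `y` weighs at most `θ x - θ y`. With equality, the reverse step is admitted because both ends
have the same ancestor. With strict inequality, the link itself yields a negative closed walk in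
`G₀` through that ancestor, so the distance there is `⊥` and every weight is admitted. This
dichotomy is `Admits.reverse`, and it carries the proof.

When a vertex is created, `θ` is chosen there to make its link tight; levels show that the vertex is
new, so older conditions are unaffected. Reweighting by `φ` adds `φ` to `θ`. Redirecting an edge
through `r̄` only composes it with a reversed link. `Shortcut.inv` combines these facts.

For the first claim, a walk in the later graph bounds the distance in `G₀`, and the edges of `G₀`
survive in the earlier graph up to reweighting. For the second, `Inv.admits_psi` admits `ψ x` from
`x` to its ancestor and `-ψ x` back, and the edge is composed with these two steps. -/

namespace HopShortcut

open Vert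

variable {ι : Type*}

/-! ### Walks and extended real distances. -/

namespace WGraph

variable {G : WGraph ι}

theorem Walk.cons {h : ℕ} {u v x : Vert ι} {c : ℝ} (he : (u, v) ∈ G.E) (hw : G.Walk h v x c) :
    ∃ h', G.Walk h' u x (G.w u v + c) := by
  by_cases hn : G.IsNegEdge u v
  · exact ⟨_, .consNeg hn hw⟩
  · exact ⟨_, .consPos he hn hw⟩

theorem Walk.append {h h' : ℕ} {u v x : Vert ι} {c c' : ℝ} (hw : G.Walk h u v c)
    (hw' : G.Walk h' v x c') : ∃ k, G.Walk k u x (c + c') := by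
  induction hw with
  | nil u => exact ⟨h', by simpa using hw'⟩
  | consNeg hn _ ih =>
    obtain ⟨k, hk⟩ := ih hw'
    rw [add_assoc]
    exact Walk.cons hn.1 hk
  | consPos he _ _ ih =>
    obtain ⟨k, hk⟩ := ih hw'
    rw [add_assoc]
    exact Walk.cons he hk

theorem Walk.dist_le {h : ℕ} {u v : Vert ι} {c : ℝ} (hw : G.Walk h u v c) :
    G.dist u v ≤ (c : EReal) :=
  sInf_le ⟨c, ⟨h, hw⟩, rfl⟩

/-- An infimum over walks need not be attained and may be `⊥`; real upper bounds treat all cases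
alike and avoid arithmetic with `⊤` and `⊥`. -/
theorem dist_le_coe_iff {u v : Vert ι} {c : ℝ} :
    G.dist u v ≤ (c : EReal) ↔ ∀ ε > 0, ∃ h c', G.Walk h u v c' ∧ c' < c + ε := by
  constructor
  · intro hd ε hε
    have hlt : G.dist u v < ((c + ε : ℝ) : EReal) :=
      hd.trans_lt (EReal.coe_lt_coe_iff.2 (by linarith))
    obtain ⟨_, ⟨c', ⟨h, hw⟩, rfl⟩, hc'⟩ := sInf_lt_iff.1 hlt
    exact ⟨h, c', hw, EReal.coe_lt_coe_iff.1 hc'⟩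
  · intro H
    refine EReal.le_of_forall_lt_iff_le.1 fun z hz => ?_
    have hz' : c < z := EReal.coe_lt_coe_iff.1 hz
    obtain ⟨h, c', hw, hc'⟩ := H (z - c) (by linarith)
    exact hw.dist_le.trans (EReal.coe_le_coe_iff.2 (by linarith))

theorem dist_triangle {u v x : Vert ι} {c c' : ℝ} (h₁ : G.dist u v ≤ (c : EReal))
    (h₂ : G.dist v x ≤ (c' : EReal)) : G.dist u x ≤ ((c + c' : ℝ) : EReal) := by
  rw [dist_le_coe_iff] at *
  intro ε hε
  obtain ⟨_, a, ha, ha'⟩ := h₁ (ε / 2) (by linarith)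
  obtain ⟨_, b, hb, hb'⟩ := h₂ (ε / 2) (by linarith)
  obtain ⟨k, hk⟩ := ha.append hb
  exact ⟨k, a + b, hk, by linarith⟩

theorem dist_self_le {u : Vert ι} {c : ℝ} (hc : 0 ≤ c) : G.dist u u ≤ (c : EReal) :=
  (Walk.nil u).dist_le.trans (EReal.coe_le_coe_iff.2 hc)

/-- On a negative closed walk, all distances are `⊥`. -/
theorem dist_self_le_of_neg {u : Vert ι} {c : ℝ} (hc : c < 0) (h : G.dist u u ≤ (c : EReal))
    (c' : ℝ) : G.dist u u ≤ (c' : EReal) := by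
  -- Going around the closed walk `n` times costs `n * c`.
  have key : ∀ n : ℕ, G.dist u u ≤ ((n * c : ℝ) : EReal) := by
    intro n
    induction n with
    | zero => exact dist_self_le (by simp)
    | succ n ih =>
      have := dist_triangle ih h
      convert this using 2
      push_cast
      ring
  -- As `c < 0`, clearing the denominator reverses the inequality and gives `n * c ≤ c'`.
  obtain ⟨n, hn⟩ := exists_nat_ge (c' / c)
  refine (key n).trans (EReal.coe_le_coe_iff.2 ?_)
  have := (div_le_iff_of_neg hc).1 hn
  exact this

end WGraph

/-! ### Calculus of admissible weights. -/

/-- The weight `W` of an edge `(x, y)` is admissible with respect to the potential `θ`: it is at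
least the distance of the ancestors in `G`, reweighted by `θ`. -/
def Admits (G : WGraph ι) (θ : Vert ι → ℝ) (x y : Vert ι) (W : ℝ) : Prop :=
  G.dist (neg x.anc) (neg y.anc) ≤ ((W - θ x + θ y : ℝ) : EReal)

namespace Admits

variable {G : WGraph ι} {θ : Vert ι → ℝ} {x y z : Vert ι} {W W' : ℝ}

theorem mono (h : Admits G θ x y W) (hW : W ≤ W') : Admits G θ x y W' :=
  le_trans h (EReal.coe_le_coe_iff.2 (by linarith))

/-- The two occurrences of `θ y` cancel, which leaves the triangle inequality in `G`. -/
theorem trans (h : Admits G θ x y W) (h' : Admits G θ y z W') : Admits G θ x z (W + W') := by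
  have := WGraph.dist_triangle h h'
  refine this.trans (EReal.coe_le_coe_iff.2 (by linarith))

theorem trans_neg (h : Admits G θ x y W) (h' : Admits G θ y z (-W')) : Admits G θ x z (W - W') :=
  (h.trans h').mono (by linarith)

theorem neg_trans (h : Admits G θ x y (-W)) (h' : Admits G θ y z W') : Admits G θ x z (W' - W) :=
  (h.trans h').mono (by linarith)

theorem of_anc_eq (ha : x.anc = y.anc) (hW : θ x - θ y ≤ W) : Admits G θ x y W := by
  unfold Admits
  rw [ha]
  exact WGraph.dist_self_le (by linarith)

/-- If `W = θ x - θ y`, the reverse step is tight. Otherwise `h` bounds the distance from the common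
ancestor to itself by a negative number, so that this distance lies below every real. -/
theorem reverse (h : Admits G θ x y W) (ha : x.anc = y.anc) (hW : W ≤ θ x - θ y) :
    Admits G θ y x (-W) := by
  rcases hW.lt_or_eq with hlt | heq
  · unfold Admits at *
    rw [ha] at h ⊢
    exact WGraph.dist_self_le_of_neg (c := W - θ x + θ y) (by linarith) h _
  · exact of_anc_eq ha.symm (by linarith)

theorem of_walk {H : WGraph ι} (hE : ∀ x y, (x, y) ∈ H.E → Admits G θ x y (H.w x y)) {h : ℕ}
    (hw : H.Walk h x y W) : Admits G θ x y W := by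
  induction hw with
  | nil u => exact of_anc_eq rfl (by simp)
  | consNeg hn _ ih => exact (hE _ _ hn.1).trans ih
  | consPos he _ _ ih => exact (hE _ _ he).trans ih

/-- Admissibility is a closed condition on `W`, so it passes from walks to their infimum; it
suffices to find a walk below each `z` exceeding the claimed bound. -/
theorem of_hopDist {H : WGraph ι} (hE : ∀ x y, (x, y) ∈ H.E → Admits G θ x y (H.w x y)) {k : ℕ}
    (hd : (W : EReal) = H.hopDist k x y) : Admits G θ x y W := by
  refine EReal.le_of_forall_lt_iff_le.1 fun z hz => ?_
  have hz' := EReal.coe_lt_coe_iff.1 hz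
  have hlt : H.hopDist k x y < ((z + θ x - θ y : ℝ) : EReal) := by
    rw [← hd]
    exact EReal.coe_lt_coe_iff.2 (by linarith)
  obtain ⟨_, ⟨c, ⟨h, -, hw⟩, rfl⟩, hc⟩ := sInf_lt_iff.1 hlt
  have hc := EReal.coe_lt_coe_iff.1 hc
  exact le_trans (of_walk hE hw) (EReal.coe_le_coe_iff.2 (by linarith))

end Admits

/-! ### The invariant, and extensions of states. -/

open State

/-- The vertex `p` is connected to its child `x` by an edge, or by a path via `r̄` if `p = r`, of
weight at most `θ p - θ x`. -/
def OutLink (θ : Vert ι → ℝ) (s : State ι) (p x : Vert ι) : Prop :=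
  ((p, x) ∈ s.E ∧ s.w p x ≤ θ p - θ x) ∨
    ∃ r, p = neg r ∧ (bar r, x) ∈ s.E ∧ s.w (neg r) (bar r) + s.w (bar r) x ≤ θ p - θ x

/-- The invariant of the algorithm. -/
structure Inv (G : WGraph ι) (θ : Vert ι → ℝ) (s : State ι) : Prop where
  neg_mem : ∀ r, neg r ∈ s.V
  bar_mem : ∀ r, bar r ∈ s.V
  pot_eq : ∀ r, θ (neg r) = s.pot (neg r)
  base : ∀ x y, (x, y) ∈ G.E → (x, y) ∈ s.E ∧ s.w x y ≤ G.w x y + s.pot x - s.pot y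
  bar_link : ∀ r, (neg r, bar r) ∈ s.E ∧ s.w (neg r) (bar r) ≤ θ (neg r) - θ (bar r)
  inSt_link : ∀ t ℓ p, inSt t ℓ p ∈ s.V →
    p ∈ s.V ∧ (inSt t ℓ p, p) ∈ s.E ∧ s.w (inSt t ℓ p) p ≤ θ (inSt t ℓ p) - θ p
  outSt_link : ∀ t ℓ p, outSt t ℓ p ∈ s.V → p ∈ s.V ∧ OutLink θ s p (outSt t ℓ p)
  nSt_link : ∀ t r, nSt t r ∈ s.V → (nSt t r, neg r) ∈ s.E ∧
    s.w (nSt t r) (neg r) ≤ θ (nSt t r) - θ (neg r) ∧ OutLink θ s (neg r) (nSt t r)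
  edge_mem : ∀ x y, (x, y) ∈ s.E → x ∈ s.V ∧ y ∈ s.V
  edge : ∀ x y, (x, y) ∈ s.E → Admits G θ x y (s.w x y)
  defIn : ∀ x y W, (x, y, W) ∈ s.defIn → x ∈ s.V ∧ y ∈ s.V ∧ Admits G θ x y W
  defOut : ∀ x y W, (x, y, W) ∈ s.defOut → x ∈ s.V ∧ y ∈ s.V ∧ Admits G θ x y W

/-- The state `s'` arises from `s` by adding vertices and edges, and lowering edge weights. -/
structure Ext (s s' : State ι) : Prop where
  V : s.V ⊆ s'.V
  E : s.E ⊆ s'.E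
  w : ∀ x y, (x, y) ∈ s.E → s'.w x y ≤ s.w x y
  light : s'.light = s.light
  pot : s'.pot = s.pot

theorem Ext.refl (s : State ι) : Ext s s := ⟨subset_rfl, subset_rfl, fun _ _ _ => le_rfl, rfl, rfl⟩

theorem Ext.trans {s s' s'' : State ι} (h : Ext s s') (h' : Ext s' s'') : Ext s s'' :=
  ⟨h.V.trans h'.V, h.E.trans h'.E, fun x y hxy => (h'.w x y (h.E hxy)).trans (h.w x y hxy),
    h'.light.trans h.light, h'.pot.trans h.pot⟩

section Links

variable {G : WGraph ι} {θ : Vert ι → ℝ} {s s' : State ι}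

theorem OutLink.mono {p x : Vert ι} (h : OutLink θ s p x) (he : Ext s s')
    (hb : ∀ r, (neg r, bar r) ∈ s.E) : OutLink θ s' p x := by
  rcases h with ⟨h₁, h₂⟩ | ⟨r, rfl, h₁, h₂⟩
  · exact .inl ⟨he.E h₁, (he.w _ _ h₁).trans h₂⟩
  · exact .inr ⟨r, rfl, he.E h₁, (add_le_add (he.w _ _ (hb r)) (he.w _ _ h₁)).trans h₂⟩

/-- Each value that `childW` can take is the weight of an existing edge or of a path via `r̄`. The
link `hl` excludes its default branch with no edge behind it. -/
theorem Inv.admits_childW (h : Inv G θ s) {p x : Vert ι} (hl : OutLink θ s p x) :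
    Admits G θ p x (s.childW p x) := by
  have key : ∀ q, (q, x) ∈ s.E → Admits G θ q x (s.w q x) := fun q hq => h.edge _ _ hq
  rcases p with r | r | ⟨t, ℓ, p⟩ | ⟨t, ℓ, p⟩ | ⟨t, r⟩
  · have hb : (bar r, x) ∈ s.E → Admits G θ (neg r) x (s.w (neg r) (bar r) + s.w (bar r) x) :=
      fun hq => (h.edge _ _ (h.bar_link r).1).trans (h.edge _ _ hq)
    simp only [State.childW]
    split_ifs with h₁ h₂
    · rcases min_choice (s.w (neg r) x) (s.w (neg r) (bar r) + s.w (bar r) x) with e | e <;> rw [e]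
      · exact key _ h₁
      · exact hb h₂
    · exact key _ h₁
    · rcases hl with hl | ⟨r', hr, h₂, -⟩
      · exact absurd hl.1 h₁
      · cases hr
        exact hb h₂
  all_goals
    rcases hl with hl | ⟨r', hr, -⟩
    · exact key _ hl.1
    · cases hr

theorem OutLink.childW_le {p x : Vert ι} (hl : OutLink θ s p x) :
    s.childW p x ≤ θ p - θ x := by
  rcases p with r | r | ⟨t, ℓ, p⟩ | ⟨t, ℓ, p⟩ | ⟨t, r⟩
  · simp only [State.childW]
    rcases hl with ⟨h₁, h₂⟩ | ⟨r', hr, h₁, h₂⟩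
    · rw [if_pos h₁]
      split_ifs
      · exact (min_le_left _ _).trans h₂
      · exact h₂
    · cases hr
      simp only [if_pos h₁]
      split_ifs
      · exact (min_le_right _ _).trans h₂
      · exact h₂
  all_goals
    rcases hl with hl | ⟨r', hr, -⟩
    · exact hl.2
    · cases hr

theorem Inv.admits_neg_childW (h : Inv G θ s) {p x : Vert ι} (hl : OutLink θ s p x)
    (ha : p.anc = x.anc) : Admits G θ x p (-s.childW p x) :=
  (h.admits_childW hl).reverse ha hl.childW_le

theorem Inv.admits_bar (h : Inv G θ s) (r : ι) :
    Admits G θ (bar r) (neg r) (-s.w (neg r) (bar r)) :=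
  (h.edge _ _ (h.bar_link r).1).reverse rfl (h.bar_link r).2

theorem Inv.admits_inSt (h : Inv G θ s) {t ℓ : ℕ} {p : Vert ι} (hx : inSt t ℓ p ∈ s.V) :
    Admits G θ (inSt t ℓ p) p (s.w (inSt t ℓ p) p) :=
  h.edge _ _ (h.inSt_link _ _ _ hx).2.1

theorem Inv.admits_inSt_rev (h : Inv G θ s) {t ℓ : ℕ} {p : Vert ι} (hx : inSt t ℓ p ∈ s.V) :
    Admits G θ p (inSt t ℓ p) (-s.w (inSt t ℓ p) p) :=
  (h.admits_inSt hx).reverse rfl (h.inSt_link _ _ _ hx).2.2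

theorem Inv.admits_outSt (h : Inv G θ s) {t ℓ : ℕ} {p : Vert ι} (hx : outSt t ℓ p ∈ s.V) :
    Admits G θ p (outSt t ℓ p) (s.childW p (outSt t ℓ p)) :=
  h.admits_childW (h.outSt_link _ _ _ hx).2

theorem Inv.admits_outSt_rev (h : Inv G θ s) {t ℓ : ℕ} {p : Vert ι} (hx : outSt t ℓ p ∈ s.V) :
    Admits G θ (outSt t ℓ p) p (-s.childW p (outSt t ℓ p)) :=
  h.admits_neg_childW (h.outSt_link _ _ _ hx).2 rfl

theorem Inv.admits_nSt (h : Inv G θ s) {t : ℕ} {r : ι} (hx : nSt t r ∈ s.V) :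
    Admits G θ (nSt t r) (neg r) (s.w (nSt t r) (neg r)) :=
  h.edge _ _ (h.nSt_link _ _ hx).1

theorem Inv.admits_nSt_rev (h : Inv G θ s) {t : ℕ} {r : ι} (hx : nSt t r ∈ s.V) :
    Admits G θ (neg r) (nSt t r) (-s.w (nSt t r) (neg r)) :=
  (h.admits_nSt hx).reverse rfl (h.nSt_link _ _ hx).2.1

theorem Inv.admits_child_nSt (h : Inv G θ s) {t : ℕ} {r : ι} (hx : nSt t r ∈ s.V) :
    Admits G θ (neg r) (nSt t r) (s.childW (neg r) (nSt t r)) :=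
  h.admits_childW (h.nSt_link _ _ hx).2.2

theorem Inv.admits_child_nSt_rev (h : Inv G θ s) {t : ℕ} {r : ι} (hx : nSt t r ∈ s.V) :
    Admits G θ (nSt t r) (neg r) (-s.childW (neg r) (nSt t r)) :=
  h.admits_neg_childW (h.nSt_link _ _ hx).2.2 rfl

/-- Upper bounds on links survive because weights only fall, so links need checking at new vertices
only. Admissibility is a lower bound on weights, so it must be supplied for all edges of `s'`. -/
theorem Inv.extend (h : Inv G θ s) (he : Ext s s')
    (hin : ∀ t ℓ p, inSt t ℓ p ∈ s'.V → inSt t ℓ p ∈ s.V ∨ (p ∈ s'.V ∧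
      (inSt t ℓ p, p) ∈ s'.E ∧ s'.w (inSt t ℓ p) p ≤ θ (inSt t ℓ p) - θ p))
    (hout : ∀ t ℓ p, outSt t ℓ p ∈ s'.V → outSt t ℓ p ∈ s.V ∨ (p ∈ s'.V ∧
      OutLink θ s' p (outSt t ℓ p)))
    (hn : ∀ t r, nSt t r ∈ s'.V → nSt t r ∈ s.V ∨ ((nSt t r, neg r) ∈ s'.E ∧
      s'.w (nSt t r) (neg r) ≤ θ (nSt t r) - θ (neg r) ∧ OutLink θ s' (neg r) (nSt t r)))
    (hedge : ∀ x y, (x, y) ∈ s'.E → x ∈ s'.V ∧ y ∈ s'.V ∧ Admits G θ x y (s'.w x y))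
    (hdin : ∀ x y W, (x, y, W) ∈ s'.defIn → x ∈ s'.V ∧ y ∈ s'.V ∧ Admits G θ x y W)
    (hdout : ∀ x y W, (x, y, W) ∈ s'.defOut → x ∈ s'.V ∧ y ∈ s'.V ∧ Admits G θ x y W) :
    Inv G θ s' where
  neg_mem r := he.V (h.neg_mem r)
  bar_mem r := he.V (h.bar_mem r)
  pot_eq r := by rw [he.pot]; exact h.pot_eq r
  base x y hxy := by
    obtain ⟨h₁, h₂⟩ := h.base x y hxy
    rw [he.pot]
    exact ⟨he.E h₁, (he.w _ _ h₁).trans h₂⟩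
  bar_link r := ⟨he.E (h.bar_link r).1, (he.w _ _ (h.bar_link r).1).trans (h.bar_link r).2⟩
  inSt_link t ℓ p hx := by
    rcases hin t ℓ p hx with hx | hx
    · obtain ⟨h₁, h₂, h₃⟩ := h.inSt_link t ℓ p hx
      exact ⟨he.V h₁, he.E h₂, (he.w _ _ h₂).trans h₃⟩
    · exact hx
  outSt_link t ℓ p hx := by
    rcases hout t ℓ p hx with hx | hx
    · obtain ⟨h₁, h₂⟩ := h.outSt_link t ℓ p hx
      exact ⟨he.V h₁, h₂.mono he fun r => (h.bar_link r).1⟩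
    · exact hx
  nSt_link t r hx := by
    rcases hn t r hx with hx | hx
    · obtain ⟨h₁, h₂, h₃⟩ := h.nSt_link t r hx
      exact ⟨he.E h₁, (he.w _ _ h₁).trans h₂, h₃.mono he fun r => (h.bar_link r).1⟩
    · exact hx
  edge_mem x y hxy := ⟨(hedge x y hxy).1, (hedge x y hxy).2.1⟩
  edge x y hxy := (hedge x y hxy).2.2
  defIn := hdin
  defOut := hdout

/-- This leaves `θ` free at vertices not yet created. -/
theorem Inv.congr {θ' : Vert ι → ℝ} (h : Inv G θ s) (hθ : ∀ x ∈ s.V, θ' x = θ x) :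
    Inv G θ' s := by
  have hA : ∀ x y W, x ∈ s.V → y ∈ s.V → Admits G θ x y W → Admits G θ' x y W := by
    intro x y W hx hy hW
    unfold Admits
    rwa [hθ x hx, hθ y hy]
  have hO : ∀ p x, p ∈ s.V → x ∈ s.V → OutLink θ s p x → OutLink θ' s p x := by
    intro p x hp hx hl
    unfold OutLink
    rwa [hθ p hp, hθ x hx]
  refine ⟨h.neg_mem, h.bar_mem, ?_, h.base, ?_, ?_, ?_, ?_, h.edge_mem, ?_, ?_, ?_⟩
  · intro r
    rw [hθ _ (h.neg_mem r), h.pot_eq]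
  · intro r
    rw [hθ _ (h.neg_mem r), hθ _ (h.bar_mem r)]
    exact h.bar_link r
  · intro t ℓ p hx
    obtain ⟨h₁, h₂, h₃⟩ := h.inSt_link t ℓ p hx
    rw [hθ _ hx, hθ _ h₁]
    exact ⟨h₁, h₂, h₃⟩
  · intro t ℓ p hx
    obtain ⟨h₁, h₂⟩ := h.outSt_link t ℓ p hx
    exact ⟨h₁, hO _ _ h₁ hx h₂⟩
  · intro t r hx
    obtain ⟨h₁, h₂, h₃⟩ := h.nSt_link t r hx
    rw [hθ _ hx, hθ _ (h.neg_mem r)]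
    exact ⟨h₁, h₂, hO _ _ (h.neg_mem r) hx h₃⟩
  · intro x y hxy
    exact hA _ _ _ (h.edge_mem x y hxy).1 (h.edge_mem x y hxy).2 (h.edge x y hxy)
  · intro x y W hxy
    obtain ⟨h₁, h₂, h₃⟩ := h.defIn x y W hxy
    exact ⟨h₁, h₂, hA _ _ _ h₁ h₂ h₃⟩
  · intro x y W hxy
    obtain ⟨h₁, h₂, h₃⟩ := h.defOut x y W hxy
    exact ⟨h₁, h₂, hA _ _ _ h₁ h₂ h₃⟩

theorem Ext.addEdge (s : State ι) (u v : Vert ι) (W : ℝ) : Ext s (s.addEdge u v W) where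
  V := subset_rfl
  E := Set.subset_insert _ _
  w x y hxy := by
    simp only [State.addEdge]
    split_ifs with h₁ h₂
    · obtain ⟨rfl, rfl⟩ := h₁
      exact min_le_left _ _
    · obtain ⟨rfl, rfl⟩ := h₁
      exact absurd hxy h₂
    · exact le_rfl
  light := rfl
  pot := rfl

theorem addEdge_w_self_le (s : State ι) (u v : Vert ι) (W : ℝ) :
    (s.addEdge u v W).w u v ≤ W := by
  simp only [State.addEdge, and_self, if_true]
  split_ifs
  · exact min_le_right _ _
  · exact le_rfl

theorem admits_addEdge {u v : Vert ι} {W : ℝ}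
    (h : ∀ x y, (x, y) ∈ s.E → Admits G θ x y (s.w x y)) (hW : Admits G θ u v W)
    (x y : Vert ι) (hxy : (x, y) ∈ (s.addEdge u v W).E) :
    Admits G θ x y ((s.addEdge u v W).w x y) := by
  simp only [State.addEdge, Set.mem_insert_iff, Prod.mk.injEq] at hxy ⊢
  split_ifs with h₁ h₂
  · obtain ⟨rfl, rfl⟩ := h₁
    rcases min_choice (s.w x y) W with e | e <;> rw [e]
    · exact h _ _ h₂
    · exact hW
  · obtain ⟨rfl, rfl⟩ := h₁
    exact hW
  · exact h _ _ (hxy.resolve_left h₁)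

end Links

/-! ### Adding edges with `θ` and the vertex set fixed. -/

/-- The state `s` satisfies the invariant and arises from `b` by adding edges. -/
structure Good (G : WGraph ι) (θ : Vert ι → ℝ) (b s : State ι) : Prop where
  inv : Inv G θ s
  ext : Ext b s
  V : s.V = b.V

namespace Good

variable {G : WGraph ι} {θ : Vert ι → ℝ} {b s : State ι}

theorem refl (h : Inv G θ s) : Good G θ s s := ⟨h, Ext.refl s, rfl⟩

theorem mem (h : Good G θ b s) {x : Vert ι} (hx : x ∈ b.V) : x ∈ s.V := h.V ▸ hx

theorem edge (h : Good G θ b s) {x y : Vert ι} (hxy : (x, y) ∈ b.E) : Admits G θ x y (s.w x y) :=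
  h.inv.edge _ _ (h.ext.E hxy)

theorem addEdge (h : Good G θ b s) {u v : Vert ι} {W : ℝ} (hu : u ∈ b.V) (hv : v ∈ b.V)
    (hW : Admits G θ u v W) : Good G θ b (s.addEdge u v W) where
  inv := by
    refine h.inv.extend (Ext.addEdge s u v W) (fun _ _ _ => .inl) (fun _ _ _ => .inl)
      (fun _ _ => .inl) (fun x y hxy => ?_) h.inv.defIn h.inv.defOut
    have hm : x ∈ s.V ∧ y ∈ s.V := by
      rcases hxy with hxy | hxy
      · cases hxy
        exact ⟨h.mem hu, h.mem hv⟩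
      · exact h.inv.edge_mem _ _ hxy
    exact ⟨hm.1, hm.2, admits_addEdge h.inv.edge hW x y hxy⟩
  ext := h.ext.trans (Ext.addEdge s u v W)
  V := h.V

theorem deferIn (h : Good G θ b s) {u v : Vert ι} {W : ℝ} (hu : u ∈ b.V) (hv : v ∈ b.V)
    (hW : Admits G θ u v W) : Good G θ b (s.deferIn u v W) := by
  have he : Ext s (s.deferIn u v W) :=
    ⟨subset_rfl, subset_rfl, fun _ _ _ => le_rfl, rfl, rfl⟩
  refine ⟨h.inv.extend he (fun _ _ _ => .inl) (fun _ _ _ => .inl) (fun _ _ => .inl) ?_ ?_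
    h.inv.defOut, h.ext.trans he, h.V⟩
  · intro x y hxy
    exact ⟨(h.inv.edge_mem x y hxy).1, (h.inv.edge_mem x y hxy).2, h.inv.edge x y hxy⟩
  · rintro x y c (hc | hc)
    · cases hc
      exact ⟨h.mem hu, h.mem hv, hW⟩
    · exact h.inv.defIn _ _ _ hc

theorem deferOut (h : Good G θ b s) {u v : Vert ι} {W : ℝ} (hu : u ∈ b.V) (hv : v ∈ b.V)
    (hW : Admits G θ u v W) : Good G θ b (s.deferOut u v W) := by
  have he : Ext s (s.deferOut u v W) :=
    ⟨subset_rfl, subset_rfl, fun _ _ _ => le_rfl, rfl, rfl⟩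
  refine ⟨h.inv.extend he (fun _ _ _ => .inl) (fun _ _ _ => .inl) (fun _ _ => .inl) ?_
    h.inv.defIn ?_, h.ext.trans he, h.V⟩
  · intro x y hxy
    exact ⟨(h.inv.edge_mem x y hxy).1, (h.inv.edge_mem x y hxy).2, h.inv.edge x y hxy⟩
  · rintro x y c (hc | hc)
    · cases hc
      exact ⟨h.mem hu, h.mem hv, hW⟩
    · exact h.inv.defOut _ _ _ hc

theorem neg_mem (h : Good G θ b s) (r : ι) : neg r ∈ b.V := h.V ▸ h.inv.neg_mem r

theorem inSt_parent (h : Good G θ b s) {t ℓ : ℕ} {p : Vert ι} (hx : inSt t ℓ p ∈ b.V) :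
    p ∈ b.V := h.V ▸ (h.inv.inSt_link _ _ _ (h.mem hx)).1

theorem outSt_parent (h : Good G θ b s) {t ℓ : ℕ} {p : Vert ι} (hx : outSt t ℓ p ∈ b.V) :
    p ∈ b.V := h.V ▸ (h.inv.outSt_link _ _ _ (h.mem hx)).1

/-- Induction along the chain of parents of `u`, for all `v`, weights and states. Each recursive
weight belongs to a walk that reaches `u` from its parent, follows `(u, v)`, and in one case
continues from `v` to its N-parent. Link weights may be read in different intermediate states,
because all of them are admissible for the same `θ`. -/
theorem addEdgeIn (h : Good G θ b s) {u v : Vert ι} {W : ℝ} (hu : u ∈ b.V) (hv : v ∈ b.V)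
    (hW : Admits G θ u v W) : Good G θ b (State.addEdgeIn u v W s) := by
  induction u generalizing v W s with
  | neg r => exact h.addEdge hu hv hW
  | bar r => exact h.addEdge hu hv hW
  | nSt t r => exact h.addEdge hu hv hW
  | outSt a ℓ p ih =>
    have h₁ := h.addEdge hu hv hW
    refine ih h₁ (h.outSt_parent hu) hv ?_
    exact ((h₁.inv.admits_outSt (h₁.mem hu)).trans hW).mono (by linarith)
  | inSt a ℓ p ih =>
    have h₁ := h.addEdge hu hv hW
    have hp := h.inSt_parent hu
    have hW₁ : Admits G θ p v (W - (s.addEdge (inSt a ℓ p) v W).w (inSt a ℓ p) p) :=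
      ((h₁.inv.admits_inSt_rev (h₁.mem hu)).trans hW).mono (by linarith)
    cases v with
    | neg r => exact ih h₁ hp hv hW₁
    | bar r => exact h₁
    | inSt _ _ _ => exact h₁
    | outSt _ _ _ => exact h₁
    | nSt t r =>
      have h₂ := h₁.deferIn hp hv hW₁
      simp only [State.addEdgeIn]
      split_ifs with hc
      · have h₃ := ih h₂ hp hv hW₁
        refine ih h₃ hp (h.neg_mem r) ?_
        -- The walk is `p → u → v → r`, whose first and last steps are reversed links.
        exact (((h₃.inv.admits_inSt_rev (h₃.mem hu)).trans hW).trans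
          (h₃.inv.admits_child_nSt_rev (h₃.mem hv))).mono (by linarith)
      · refine ih h₂ hp (h.neg_mem r) ?_
        exact (((h₂.inv.admits_inSt_rev (h₂.mem hu)).trans hW).trans
          (h₂.inv.admits_child_nSt_rev (h₂.mem hv))).mono (by linarith)

theorem addEdgeOut (h : Good G θ b s) {u v : Vert ι} {W : ℝ} (hu : u ∈ b.V) (hv : v ∈ b.V)
    (hW : Admits G θ u v W) : Good G θ b (State.addEdgeOut v u W s) := by
  induction v generalizing u W s with
  | neg r => exact h.addEdge hu hv hW
  | bar r => exact h.addEdge hu hv hW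
  | nSt t r => exact h.addEdge hu hv hW
  | inSt a ℓ p ih =>
    have h₁ := h.addEdge hu hv hW
    exact ih h₁ hu (h.inSt_parent hv) (hW.trans (h₁.inv.admits_inSt (h₁.mem hv)))
  | outSt a ℓ p ih =>
    have h₁ := h.addEdge hu hv hW
    have hp := h.outSt_parent hv
    have hW₁ : Admits G θ u p (W - (s.addEdge u (outSt a ℓ p) W).childW p (outSt a ℓ p)) :=
      (hW.trans (h₁.inv.admits_outSt_rev (h₁.mem hv))).mono (by linarith)
    cases u with
    | neg r => exact ih h₁ hu hp hW₁
    | bar r => exact h₁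
    | inSt _ _ _ => exact h₁
    | outSt _ _ _ => exact h₁
    | nSt t r =>
      have h₂ := h₁.deferOut hu hp hW₁
      simp only [State.addEdgeOut]
      split_ifs with hc
      · have h₃ := ih h₂ hu hp hW₁
        refine ih h₃ (h.neg_mem r) hp ?_
        exact (((h₃.inv.admits_nSt_rev (h₃.mem hu)).trans hW).trans
          (h₃.inv.admits_outSt_rev (h₃.mem hv))).mono (by linarith)
      · refine ih h₂ (h.neg_mem r) hp ?_
        exact (((h₂.inv.admits_nSt_rev (h₂.mem hu)).trans hW).trans
          (h₂.inv.admits_outSt_rev (h₂.mem hv))).mono (by linarith)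

end Good

/-! ### Induction along loops in arbitrary order. -/

theorem RunList.induct {σ β : Type*} {step : β → σ → σ → Prop} {P : σ → Prop} {l : List β}
    {s s' : σ} (hr : RunList step l s s')
    (hstep : ∀ b ∈ l, ∀ s s', P s → step b s s' → P s') (hs : P s) : P s' := by
  induction hr with
  | nil s => exact hs
  | cons hb _ ih =>
    exact ih (fun b' hb' => hstep b' (List.mem_cons_of_mem _ hb'))
      (hstep _ List.mem_cons_self _ _ hs hb)

theorem ForEach.induct {σ β : Type*} {step : β → σ → σ → Prop} {P : σ → Prop} {S : Set β}
    {s s' : σ} (hr : ForEach S step s s')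
    (hstep : ∀ b ∈ S, ∀ s s', P s → step b s s' → P s') (hs : P s) : P s' := by
  obtain ⟨l, -, hl, hr⟩ := hr
  exact hr.induct (fun b hb => hstep b ((hl b).1 hb)) hs

theorem RunList.of_foldl {σ β : Type*} (f : σ → β → σ) (l : List β) (s : σ) :
    RunList (fun b s s' => s' = f s b) l s (l.foldl f s) := by
  induction l generalizing s with
  | nil => exact .nil s
  | cons b l ih => exact .cons rfl (ih _)

/-! ### Creation of auxiliary vertices. -/

section Creation

variable {G : WGraph ι}

/-- If the step for `b` creates exactly the vertices `X b`, and these sets are disjoint, then the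
loop over `l` creates their union. -/
theorem RunList.grow {β : Type*} {step : β → State ι → State ι → Prop} {X : β → Set (Vert ι)}
    {Q : β → State ι → Prop} {b₀ : State ι} {l : List β} {s s' : State ι}
    (hr : RunList step l s s')
    (hstep : ∀ b ∈ l, ∀ s s', (∃ θ, Inv G θ s) → Ext b₀ s → Disjoint (X b) s.V → step b s s' →
      (∃ θ, Inv G θ s') ∧ Ext s s' ∧ s'.V = s.V ∪ X b ∧ Q b s')
    (hQ : ∀ b s s', Ext s s' → Q b s → Q b s')
    (hX : l.Pairwise fun b b' => Disjoint (X b) (X b')) (hs : ∃ θ, Inv G θ s) (hb : Ext b₀ s)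
    (hV : ∀ b ∈ l, Disjoint (X b) s.V) :
    (∃ θ, Inv G θ s') ∧ Ext s s' ∧ (∀ x ∈ s'.V, x ∈ s.V ∨ ∃ b ∈ l, x ∈ X b) ∧
      ∀ b ∈ l, Q b s' := by
  induction hr with
  | nil s => exact ⟨hs, Ext.refl s, fun x hx => .inl hx, by simp⟩
  | @cons b l s₁ s₂ s₃ hstep₁ _ ih =>
    obtain ⟨h₁, h₂, h₃, h₄⟩ := hstep b List.mem_cons_self _ _ hs hb (hV b List.mem_cons_self) hstep₁
    rw [List.pairwise_cons] at hX
    obtain ⟨i₁, i₂, i₃, i₄⟩ := ih (fun b' hb' => hstep b' (List.mem_cons_of_mem _ hb')) hX.2 h₁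
      -- Later families remain fresh: they avoid the old vertices and are disjoint from the family
      -- just created.
      (hb.trans h₂) (fun b' hb' => by
        rw [h₃, Set.disjoint_union_right]
        exact ⟨hV b' (List.mem_cons_of_mem _ hb'), (hX.1 b' hb').symm⟩)
    refine ⟨i₁, h₂.trans i₂, fun x hx => ?_, fun b' hb' => ?_⟩
    · rcases i₃ x hx with hx | ⟨b', hb', hx⟩
      · rw [h₃] at hx
        exact hx.imp id fun hx => ⟨b, List.mem_cons_self, hx⟩
      · exact .inr ⟨b', List.mem_cons_of_mem _ hb', hx⟩
    · rcases List.mem_cons.1 hb' with rfl | hb'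
      · exact hQ _ _ _ i₂ h₄
      · exact i₄ b' hb'

theorem Ext.addVertex (s : State ι) (x : Vert ι) : Ext s (s.addVertex x) :=
  ⟨Set.subset_insert _ _, subset_rfl, fun _ _ _ => le_rfl, rfl, rfl⟩

variable {θ : Vert ι → ℝ} {s : State ι}

-- For any real `ω`, setting `θ` to `θ v + ω` at the new vertex makes its link tight; the actual
-- choice of `ω` in the gadget matters only for efficiency.
open Classical in
theorem Inv.addInVertex (h : Inv G θ s) {t ℓ : ℕ} {v : Vert ι} (hv : v ∈ s.V)
    (hx : inSt t ℓ v ∉ s.V) (ω : ℝ) :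
    ∃ θ', Inv G θ' ((s.addVertex (inSt t ℓ v)).addEdge (inSt t ℓ v) v ω) := by
  have hvx : v ≠ inSt t ℓ v := ne_of_mem_of_not_mem hv hx
  have h' : Inv G (Function.update θ (inSt t ℓ v) (θ v + ω)) s :=
    h.congr fun y hy => Function.update_of_ne (ne_of_mem_of_not_mem hy hx) _ _
  set θ' := Function.update θ (inSt t ℓ v) (θ v + ω) with hθ'
  have e₁ : θ' (inSt t ℓ v) = θ v + ω := Function.update_self ..
  have e₂ : θ' v = θ v := Function.update_of_ne hvx _ _
  have hA : Admits G θ' (inSt t ℓ v) v ω := .of_anc_eq rfl (by rw [e₁, e₂]; linarith)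
  refine ⟨θ', h'.extend ((Ext.addVertex _ _).trans (Ext.addEdge _ _ _ _)) ?_ ?_ ?_ ?_ ?_ ?_⟩
  · rintro a j p (hy | hy)
    · cases hy
      refine .inr ⟨.inr hv, .inl rfl, (addEdge_w_self_le _ _ _ _).trans ?_⟩
      rw [e₁, e₂]
      linarith
    · exact .inl hy
  · rintro a j p (hy | hy)
    · cases hy
    · exact .inl hy
  · rintro a r (hy | hy)
    · cases hy
    · exact .inl hy
  · intro y z hyz
    refine ⟨?_, ?_, admits_addEdge (s := s.addVertex _) h'.edge hA y z hyz⟩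
    all_goals
      rcases hyz with hyz | hyz
      · cases hyz
        first
        | exact .inl rfl
        | exact .inr hv
      · first
        | exact .inr (h.edge_mem _ _ hyz).1
        | exact .inr (h.edge_mem _ _ hyz).2
  · intro y z W hyz
    obtain ⟨h₁, h₂, h₃⟩ := h'.defIn y z W hyz
    exact ⟨.inr h₁, .inr h₂, h₃⟩
  · intro y z W hyz
    obtain ⟨h₁, h₂, h₃⟩ := h'.defOut y z W hyz
    exact ⟨.inr h₁, .inr h₂, h₃⟩

-- The extra bound on `ω` allows the edge `(v, x)` itself to be reversed, as the gadget subtracts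
-- its plain weight and not `childW`.
open Classical in
theorem Inv.addOutVertex (h : Inv G θ s) {t ℓ : ℕ} {v : Vert ι} (hv : v ∈ s.V)
    (hx : outSt t ℓ v ∉ s.V) (ω : ℝ) :
    ∃ θ', Inv G θ' ((s.addVertex (outSt t ℓ v)).addEdge v (outSt t ℓ v) ω) ∧
      ω ≤ θ' v - θ' (outSt t ℓ v) := by
  have hvx : v ≠ outSt t ℓ v := ne_of_mem_of_not_mem hv hx
  have h' : Inv G (Function.update θ (outSt t ℓ v) (θ v - ω)) s :=
    h.congr fun y hy => Function.update_of_ne (ne_of_mem_of_not_mem hy hx) _ _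
  set θ' := Function.update θ (outSt t ℓ v) (θ v - ω) with hθ'
  have e₁ : θ' (outSt t ℓ v) = θ v - ω := Function.update_self ..
  have e₂ : θ' v = θ v := Function.update_of_ne hvx _ _
  have hA : Admits G θ' v (outSt t ℓ v) ω := .of_anc_eq rfl (by rw [e₁, e₂]; linarith)
  refine ⟨θ', h'.extend ((Ext.addVertex _ _).trans (Ext.addEdge _ _ _ _)) ?_ ?_ ?_ ?_ ?_ ?_,
    by rw [e₁, e₂]; linarith⟩
  · rintro a j p (hy | hy)
    · cases hy
    · exact .inl hy
  · rintro a j p (hy | hy)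
    · cases hy
      refine .inr ⟨.inr hv, .inl ⟨.inl rfl, (addEdge_w_self_le _ _ _ _).trans ?_⟩⟩
      rw [e₁, e₂]
      linarith
    · exact .inl hy
  · rintro a r (hy | hy)
    · cases hy
    · exact .inl hy
  · intro y z hyz
    refine ⟨?_, ?_, admits_addEdge (s := s.addVertex _) h'.edge hA y z hyz⟩
    all_goals
      rcases hyz with hyz | hyz
      · cases hyz
        first
        | exact .inl rfl
        | exact .inr hv
      · first
        | exact .inr (h.edge_mem _ _ hyz).1
        | exact .inr (h.edge_mem _ _ hyz).2
  · intro y z W hyz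
    obtain ⟨h₁, h₂, h₃⟩ := h'.defIn y z W hyz
    exact ⟨.inr h₁, .inr h₂, h₃⟩
  · intro y z W hyz
    obtain ⟨h₁, h₂, h₃⟩ := h'.defOut y z W hyz
    exact ⟨.inr h₁, .inr h₂, h₃⟩

-- The two new edges have opposite weights, so one value of `θ` makes both tight.
open Classical in
theorem Inv.addNSteiner (h : Inv G θ s) {t : ℕ} {Δ : ι → ℝ} {r : ι} (hx : nSt t r ∉ s.V) :
    ∃ θ', Inv G θ' (s.addNSteiner t Δ r) := by
  have hr := h.neg_mem r
  have h' : Inv G (Function.update θ (nSt t r) (θ (neg r) + Δ r)) s :=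
    h.congr fun y hy => Function.update_of_ne (ne_of_mem_of_not_mem hy hx) _ _
  set θ' := Function.update θ (nSt t r) (θ (neg r) + Δ r) with hθ'
  have e₁ : θ' (nSt t r) = θ (neg r) + Δ r := Function.update_self ..
  have e₂ : θ' (neg r) = θ (neg r) := Function.update_of_ne (by simp) _ _
  have hA : Admits G θ' (nSt t r) (neg r) (Δ r) := .of_anc_eq rfl (by rw [e₁, e₂]; linarith)
  have hB : Admits G θ' (neg r) (nSt t r) (-Δ r) := .of_anc_eq rfl (by rw [e₁, e₂]; linarith)
  refine ⟨θ', h'.extend (((Ext.addVertex _ _).trans (Ext.addEdge _ _ _ _)).trans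
    (Ext.addEdge _ _ _ _)) ?_ ?_ ?_ ?_ ?_ ?_⟩
  · rintro a j p (hy | hy)
    · cases hy
    · exact .inl hy
  · rintro a j p (hy | hy)
    · cases hy
    · exact .inl hy
  · rintro a r' (hy | hy)
    · cases hy
      refine .inr ⟨.inr (.inl rfl), ((Ext.addEdge _ _ _ _).w _ _ (Set.mem_insert _ _)).trans
        ((addEdge_w_self_le _ _ _ _).trans ?_),
        .inl ⟨.inl rfl, (addEdge_w_self_le _ _ _ _).trans ?_⟩⟩ <;>
      · rw [e₁, e₂]
        linarith
    · exact .inl hy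
  · intro y z hyz
    refine ⟨?_, ?_, admits_addEdge (admits_addEdge (s := s.addVertex _) h'.edge hA) hB y z hyz⟩
    all_goals
      rcases hyz with hyz | hyz | hyz
      · cases hyz
        first
        | exact .inl rfl
        | exact .inr hr
      · cases hyz
        first
        | exact .inl rfl
        | exact .inr hr
      · first
        | exact .inr (h.edge_mem _ _ hyz).1
        | exact .inr (h.edge_mem _ _ hyz).2
  · intro y z W hyz
    obtain ⟨h₁, h₂, h₃⟩ := h'.defIn y z W hyz
    exact ⟨.inr h₁, .inr h₂, h₃⟩
  · intro y z W hyz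
    obtain ⟨h₁, h₂, h₃⟩ := h'.defOut y z W hyz
    exact ⟨.inr h₁, .inr h₂, h₃⟩

/-- Every further edge into the new vertex is a walk to `v` followed by the reversed link from `v`.
For this a single value of `θ` at the new vertex suffices, and the order of `l` plays no role. -/
theorem Inv.addInSteiner (h : Inv G θ s) {t ℓ : ℕ} {v : Vert ι} {l : List (Vert ι)} (hv : v ∈ s.V)
    (hx : inSt t ℓ v ∉ s.V) (hl : ∀ u ∈ l, (u, v) ∈ s.E) :
    (∃ θ', Inv G θ' (s.addInSteiner t v l ℓ)) ∧ Ext s (s.addInSteiner t v l ℓ) ∧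
      (s.addInSteiner t v l ℓ).V = s.V ∪ {inSt t ℓ v} := by
  set ω := s.w (l.getD (l.length - 2 ^ ℓ - 1) v) v with hω
  obtain ⟨θ', h₁⟩ := h.addInVertex hv hx ω
  set s₁ := (s.addVertex (inSt t ℓ v)).addEdge (inSt t ℓ v) v ω with hs₁
  have he : Ext s s₁ := (Ext.addVertex _ _).trans (Ext.addEdge _ _ _ _)
  have hx₁ : inSt t ℓ v ∈ s₁.V := .inl rfl
  have hv₁ : v ∈ s₁.V := .inr hv
  suffices H : Good G θ' s₁ (s.addInSteiner t v l ℓ) by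
    refine ⟨⟨θ', H.inv⟩, he.trans H.ext, ?_⟩
    rw [H.V, Set.union_singleton]
    rfl
  have h₂ := List.foldlRecOn (motive := Good G θ' s₁) (l.take (l.length - 2 ^ ℓ)) (fun s u =>
    let s' := s.addEdge u (inSt t ℓ v) (s.w u v - s.w (inSt t ℓ v) v)
    match u with
    | outSt _ _ p => s'.addEdge p (inSt t ℓ v) (s'.childW p u + s'.w u v - s'.w (inSt t ℓ v) v)
    | _ => s') (Good.refl h₁) (by
      intro σ hσ u hu
      have hE : (u, v) ∈ s₁.E := he.E (hl u (List.mem_of_mem_take hu))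
      have hu₁ : u ∈ s₁.V := (h₁.edge_mem _ _ hE).1
      have hσ' : Good G θ' s₁ (σ.addEdge u (inSt t ℓ v) (σ.w u v - σ.w (inSt t ℓ v) v)) :=
        hσ.addEdge hu₁ hx₁
          (((hσ.edge hE).trans (hσ.inv.admits_inSt_rev (hσ.mem hx₁))).mono (by linarith))
      cases u with
      | outSt a j p =>
        exact hσ'.addEdge (hσ'.outSt_parent hu₁) hx₁
          ((((hσ'.inv.admits_outSt (hσ'.mem hu₁)).trans (hσ'.edge hE)).trans
            (hσ'.inv.admits_inSt_rev (hσ'.mem hx₁))).mono (by linarith))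
      | _ => exact hσ')
  cases v with
  | neg r =>
    exact h₂.addEdge hv₁ hx₁ (h₂.inv.admits_inSt_rev (h₂.mem hx₁))
  | nSt a r =>
    exact h₂.addEdge (h₂.neg_mem r) hx₁ ((h₂.inv.admits_child_nSt (h₂.mem hv₁)).trans_neg
      (h₂.inv.admits_inSt_rev (h₂.mem hx₁)))
  | _ => exact h₂

theorem Inv.addOutSteiner (h : Inv G θ s) {t ℓ : ℕ} {v : Vert ι} {l : List (Vert ι)}
    (hv : v ∈ s.V) (hx : outSt t ℓ v ∉ s.V) (hl : ∀ u ∈ l, (v, u) ∈ s.E) :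
    (∃ θ', Inv G θ' (s.addOutSteiner t v l ℓ)) ∧ Ext s (s.addOutSteiner t v l ℓ) ∧
      (s.addOutSteiner t v l ℓ).V = s.V ∪ {outSt t ℓ v} := by
  set ω := s.w v (l.getD (l.length - 2 ^ ℓ - 1) v) with hω
  obtain ⟨θ', h₁, hθ'⟩ := h.addOutVertex hv hx ω
  set s₁ := (s.addVertex (outSt t ℓ v)).addEdge v (outSt t ℓ v) ω with hs₁
  have he : Ext s s₁ := (Ext.addVertex _ _).trans (Ext.addEdge _ _ _ _)
  have hx₁ : outSt t ℓ v ∈ s₁.V := .inl rfl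
  have hv₁ : v ∈ s₁.V := .inr hv
  have hvx : (v, outSt t ℓ v) ∈ s₁.E := .inl rfl
  -- During the loop the edge `(v, x)` can only become lighter, so it stays reversible.
  have hrev : ∀ σ, Good G θ' s₁ σ → Admits G θ' (outSt t ℓ v) v (-σ.w v (outSt t ℓ v)) :=
    fun σ hσ => (hσ.edge hvx).reverse rfl
      (((hσ.ext.w _ _ hvx).trans (addEdge_w_self_le _ _ _ _)).trans hθ')
  suffices H : Good G θ' s₁ (s.addOutSteiner t v l ℓ) by
    refine ⟨⟨θ', H.inv⟩, he.trans H.ext, ?_⟩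
    rw [H.V, Set.union_singleton]
    rfl
  have h₂ := List.foldlRecOn (motive := Good G θ' s₁) (l.take (l.length - 2 ^ ℓ)) (fun s u =>
    let s' := s.addEdge (outSt t ℓ v) u (s.w v u - s.w v (outSt t ℓ v))
    match u with
    | inSt _ _ p => s'.addEdge (outSt t ℓ v) p (s'.w v u + s'.w u p - s'.w v (outSt t ℓ v))
    | _ => s') (Good.refl h₁) (by
      intro σ hσ u hu
      have hE : (v, u) ∈ s₁.E := he.E (hl u (List.mem_of_mem_take hu))
      have hu₁ : u ∈ s₁.V := (h₁.edge_mem _ _ hE).2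
      have hσ' : Good G θ' s₁ (σ.addEdge (outSt t ℓ v) u (σ.w v u - σ.w v (outSt t ℓ v))) :=
        hσ.addEdge hx₁ hu₁ (((hrev σ hσ).trans (hσ.edge hE)).mono (by linarith))
      cases u with
      | inSt a j p =>
        exact hσ'.addEdge hx₁ (hσ'.inSt_parent hu₁)
          ((((hrev _ hσ').trans (hσ'.edge hE)).trans
            (hσ'.inv.admits_inSt (hσ'.mem hu₁))).mono (by linarith))
      | _ => exact hσ')
  cases v with
  | bar r =>
    exact h₂.addEdge hx₁ (h₂.neg_mem r) ((hrev _ h₂).neg_trans (h₂.inv.admits_bar r))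
  | nSt a r =>
    exact h₂.addEdge hx₁ (h₂.neg_mem r) ((hrev _ h₂).neg_trans
      (h₂.inv.admits_nSt (h₂.mem hv₁)))
  | _ => exact h₂

theorem addInGadget_grow {t : ℕ} {v : Vert ι} {l : List (Vert ι)} (hs : ∃ θ, Inv G θ s)
    (hv : v ∈ s.V) (hx : ∀ ℓ < Nat.clog 2 l.length, inSt t ℓ v ∉ s.V) (hl : ∀ u ∈ l, (u, v) ∈ s.E) :
    (∃ θ, Inv G θ (s.addInGadget t v l)) ∧ Ext s (s.addInGadget t v l) ∧
      (s.addInGadget t v l).V = s.V ∪ {x | ∃ ℓ < Nat.clog 2 l.length, x = inSt t ℓ v} := by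
  have hr := RunList.of_foldl (fun s ℓ => State.addInSteiner t v l ℓ s)
    (List.range (Nat.clog 2 l.length)) s
  obtain ⟨h₁, h₂, h₃, h₄⟩ := hr.grow (G := G) (X := fun ℓ => {inSt t ℓ v})
    (Q := fun ℓ σ => inSt t ℓ v ∈ σ.V) (b₀ := s) (by
      rintro ℓ - σ σ' ⟨θ, hθ⟩ he hd rfl
      obtain ⟨i₁, i₂, i₃⟩ := hθ.addInSteiner (he.V hv) (Set.disjoint_singleton_left.1 hd)
        fun u hu => he.E (hl u hu)
      exact ⟨i₁, i₂, i₃, i₃ ▸ .inr rfl⟩)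
    (fun _ _ _ he hm => he.V hm)
    (List.nodup_range.imp fun hne => by simpa using hne) hs (Ext.refl s)
    (fun ℓ hℓ => Set.disjoint_singleton_left.2 (hx ℓ (List.mem_range.1 hℓ)))
  refine ⟨h₁, h₂, subset_antisymm (fun x hxm => ?_) (Set.union_subset h₂.V ?_)⟩
  · exact (h₃ x hxm).imp id fun ⟨ℓ, hℓ, e⟩ => ⟨ℓ, List.mem_range.1 hℓ, e⟩
  · rintro _ ⟨ℓ, hℓ, rfl⟩
    exact h₄ ℓ (List.mem_range.2 hℓ)

theorem addOutGadget_grow {t : ℕ} {v : Vert ι} {l : List (Vert ι)} (hs : ∃ θ, Inv G θ s)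
    (hv : v ∈ s.V) (hx : ∀ ℓ < Nat.clog 2 l.length, outSt t ℓ v ∉ s.V) (hl : ∀ u ∈ l, (v, u) ∈ s.E) :
    (∃ θ, Inv G θ (s.addOutGadget t v l)) ∧ Ext s (s.addOutGadget t v l) ∧
      (s.addOutGadget t v l).V = s.V ∪ {x | ∃ ℓ < Nat.clog 2 l.length, x = outSt t ℓ v} := by
  have hr := RunList.of_foldl (fun s ℓ => State.addOutSteiner t v l ℓ s)
    (List.range (Nat.clog 2 l.length)) s
  obtain ⟨h₁, h₂, h₃, h₄⟩ := hr.grow (G := G) (X := fun ℓ => {outSt t ℓ v})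
    (Q := fun ℓ σ => outSt t ℓ v ∈ σ.V) (b₀ := s) (by
      rintro ℓ - σ σ' ⟨θ, hθ⟩ he hd rfl
      obtain ⟨i₁, i₂, i₃⟩ := hθ.addOutSteiner (he.V hv) (Set.disjoint_singleton_left.1 hd)
        fun u hu => he.E (hl u hu)
      exact ⟨i₁, i₂, i₃, i₃ ▸ .inr rfl⟩)
    (fun _ _ _ he hm => he.V hm)
    (List.nodup_range.imp fun hne => by simpa using hne) hs (Ext.refl s)
    (fun ℓ hℓ => Set.disjoint_singleton_left.2 (hx ℓ (List.mem_range.1 hℓ)))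
  refine ⟨h₁, h₂, subset_antisymm (fun x hxm => ?_) (Set.union_subset h₂.V ?_)⟩
  · exact (h₃ x hxm).imp id fun ⟨ℓ, hℓ, e⟩ => ⟨ℓ, List.mem_range.1 hℓ, e⟩
  · rintro _ ⟨ℓ, hℓ, rfl⟩
    exact h₄ ℓ (List.mem_range.2 hℓ)

end Creation

/-! ### Shortcut edges at the N-Steiner vertices. -/

section Shortcuts

variable {G : WGraph ι} {θ : Vert ι → ℝ} {s₀ b : State ι} {t : ℕ} {r : ι} {δ : ℝ}

/-- The situation during the generation of shortcuts around `r`: `s₀` is the state at the time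
when the distances and the lists were frozen, `b` a later state that contains the N-Steiner vertex
`r̃_t`. -/
structure HubAt (G : WGraph ι) (θ : Vert ι → ℝ) (s₀ b : State ι) (t : ℕ) (r : ι) (δ : ℝ) :
    Prop where
  inv : ∃ θ₀, Inv G θ₀ s₀
  ext : Ext s₀ b
  mem : nSt t r ∈ b.V
  to_hub : Admits G θ (neg r) (nSt t r) (-δ)
  from_hub : Admits G θ (nSt t r) (neg r) δ

theorem HubAt.mem_of_edge (h : HubAt G θ s₀ b t r δ) {x y : Vert ι} (hxy : (x, y) ∈ s₀.E) :
    x ∈ s₀.V ∧ y ∈ s₀.V := by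
  obtain ⟨θ₀, h₀⟩ := h.inv
  exact h₀.edge_mem _ _ hxy

theorem HubAt.inSt_parent (h : HubAt G θ s₀ b t r δ) {a ℓ : ℕ} {p : Vert ι}
    (hx : inSt a ℓ p ∈ s₀.V) : p ∈ s₀.V := by
  obtain ⟨θ₀, h₀⟩ := h.inv
  exact (h₀.inSt_link _ _ _ hx).1

theorem HubAt.outSt_parent (h : HubAt G θ s₀ b t r δ) {a ℓ : ℕ} {p : Vert ι}
    (hx : outSt a ℓ p ∈ s₀.V) : p ∈ s₀.V := by
  obtain ⟨θ₀, h₀⟩ := h.inv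
  exact (h₀.outSt_link _ _ _ hx).1

/-- Edges into `r̃_t` that come from a path to `r`. -/
theorem HubAt.addEdgeIn (h : HubAt G θ s₀ b t r δ) {s : State ι} (hs : Good G θ b s)
    {u : Vert ι} {c : ℝ} (hu : u ∈ b.V) (hc : Admits G θ u (neg r) c) :
    Good G θ b (State.addEdgeIn u (nSt t r) (c - δ) s) :=
  hs.addEdgeIn hu h.mem (hc.trans_neg h.to_hub)

/-- Edges out of `r̃_t` that come from a path from `r`. -/
theorem HubAt.addEdgeOut (h : HubAt G θ s₀ b t r δ) {s : State ι} (hs : Good G θ b s)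
    {u : Vert ι} {c : ℝ} (hu : u ∈ b.V) (hc : Admits G θ (neg r) u c) :
    Good G θ b (State.addEdgeOut u (nSt t r) (c + δ) s) :=
  hs.addEdgeOut h.mem hu ((h.from_hub.trans hc).mono (by linarith))

/-- The finite tentative distances to `r` are admissible. -/
def DistIn (G : WGraph ι) (θ : Vert ι → ℝ) (s₀ : State ι) (r : ι) (d : Vert ι → WithTop ℝ) :
    Prop :=
  ∀ (v : Vert ι) (x : ℝ), d v = (x : WithTop ℝ) → v ∈ s₀.V ∧ Admits G θ v (neg r) x

/-- The finite tentative distances from `r` are admissible. -/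
def DistOut (G : WGraph ι) (θ : Vert ι → ℝ) (s₀ : State ι) (r : ι) (d : Vert ι → WithTop ℝ) :
    Prop :=
  ∀ (v : Vert ι) (x : ℝ), d v = (x : WithTop ℝ) → v ∈ s₀.V ∧ Admits G θ (neg r) v x

open Classical in
theorem relax_eq_coe {d : Vert ι → WithTop ℝ} {p v : Vert ι} {W x : ℝ}
    (h : relax d p W v = (x : WithTop ℝ)) : d v = (x : WithTop ℝ) ∨ v = p ∧ x = W := by
  by_cases hv : v = p
  · subst hv
    rw [relax, Function.update_self] at h
    rcases min_choice (d v) (W : WithTop ℝ) with e | e <;> rw [e] at h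
    · exact .inl h
    · exact .inr ⟨rfl, (WithTop.coe_inj.1 h).symm⟩
  · rw [relax, Function.update_of_ne hv] at h
    exact .inl h

theorem DistIn.relax {d : Vert ι → WithTop ℝ} (h : DistIn G θ s₀ r d) {p : Vert ι} {W : ℝ}
    (hp : p ∈ s₀.V) (hW : Admits G θ p (neg r) W) : DistIn G θ s₀ r (relax d p W) := by
  intro v x hx
  rcases relax_eq_coe hx with hx | ⟨rfl, rfl⟩
  · exact h v x hx
  · exact ⟨hp, hW⟩

theorem DistOut.relax {d : Vert ι → WithTop ℝ} (h : DistOut G θ s₀ r d) {p : Vert ι} {W : ℝ}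
    (hp : p ∈ s₀.V) (hW : Admits G θ (neg r) p W) : DistOut G θ s₀ r (relax d p W) := by
  intro v x hx
  rcases relax_eq_coe hx with hx | ⟨rfl, rfl⟩
  · exact h v x hx
  · exact ⟨hp, hW⟩

theorem HubAt.scInOut (h : HubAt G θ s₀ b t r δ) {s : State ι} (hs : Good G θ b s) {v : Vert ι}
    {x : ℝ} (hv : v ∈ s₀.V) (hx : Admits G θ v (neg r) x) :
    Good G θ b (scInOut t r δ v x s) := by
  cases v with
  | outSt a ℓ p =>
    simp only [HopShortcut.scInOut]
    split_ifs
    · exact h.addEdgeIn hs (h.ext.V (h.outSt_parent hv))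
        ((hs.inv.admits_outSt (hs.mem (h.ext.V hv))).trans hx)
    · exact hs
  | _ => exact hs

theorem HubAt.scOutIn (h : HubAt G θ s₀ b t r δ) {s : State ι} (hs : Good G θ b s) {v : Vert ι}
    {x : ℝ} (hv : v ∈ s₀.V) (hx : Admits G θ (neg r) v x) :
    Good G θ b (scOutIn t r δ v x s) := by
  cases v with
  | inSt a ℓ p =>
    simp only [HopShortcut.scOutIn]
    split_ifs
    · exact h.addEdgeOut hs (h.ext.V (h.inSt_parent hv))
        (hx.trans (hs.inv.admits_inSt (hs.mem (h.ext.V hv))))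
    · exact hs
  | _ => exact hs

/-- Both outcomes extend the walk from `v` to `r` backwards through `u`: the hub edge replaces `r`
by `r̃_t` at its end, and the relaxation prepends the reversed link from the parent of `u`. -/
theorem HubAt.scInScan (h : HubAt G θ s₀ b t r δ) {c : State ι × (Vert ι → WithTop ℝ)}
    (hs : Good G θ b c.1) (hd : DistIn G θ s₀ r c.2) {u v : Vert ι} {x : ℝ}
    (hx : Admits G θ v (neg r) x) (hu : (u, v) ∈ s₀.E) :
    Good G θ b (scInScan t r δ v x c u).1 ∧ DistIn G θ s₀ r (scInScan t r δ v x c u).2 := by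
  have hus := (h.mem_of_edge hu).1
  have hux : Admits G θ u (neg r) (c.1.w u v + x) := (hs.edge (h.ext.E hu)).trans hx
  have hother : ∀ c' : State ι × (Vert ι → WithTop ℝ), c' = (if 0 ≤ c.1.w u v + x - δ then
      (State.addEdgeIn u (nSt t r) (c.1.w u v + x - δ) c.1, c.2) else c) →
      Good G θ b c'.1 ∧ DistIn G θ s₀ r c'.2 := by
    rintro _ rfl
    split_ifs
    · exact ⟨h.addEdgeIn hs (h.ext.V hus) hux, hd⟩
    · exact ⟨hs, hd⟩
  cases u with
  | inSt a ℓ p =>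
    simp only [HopShortcut.scInScan]
    split_ifs with h₁ h₂ h₂
    · exact ⟨hs, hd.relax (h.inSt_parent hus)
        ((hs.inv.admits_inSt_rev (hs.mem (h.ext.V hus))).neg_trans hux)⟩
    · exact ⟨hs, hd⟩
    · exact ⟨h.addEdgeIn hs (h.ext.V hus) hux, hd⟩
    · exact ⟨hs, hd⟩
  | _ => exact hother _ rfl

theorem HubAt.scOutScan (h : HubAt G θ s₀ b t r δ) {c : State ι × (Vert ι → WithTop ℝ)}
    (hs : Good G θ b c.1) (hd : DistOut G θ s₀ r c.2) {u v : Vert ι} {x : ℝ}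
    (hx : Admits G θ (neg r) v x) (hu : (v, u) ∈ s₀.E) :
    Good G θ b (scOutScan t r δ v x c u).1 ∧ DistOut G θ s₀ r (scOutScan t r δ v x c u).2 := by
  have hus := (h.mem_of_edge hu).2
  have hux : Admits G θ (neg r) u (x + c.1.w v u) := hx.trans (hs.edge (h.ext.E hu))
  have hother : ∀ c' : State ι × (Vert ι → WithTop ℝ), c' = (if 0 ≤ x + c.1.w v u + δ then
      (State.addEdgeOut u (nSt t r) (x + c.1.w v u + δ) c.1, c.2) else c) →
      Good G θ b c'.1 ∧ DistOut G θ s₀ r c'.2 := by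
    rintro _ rfl
    split_ifs
    · exact ⟨h.addEdgeOut hs (h.ext.V hus) hux, hd⟩
    · exact ⟨hs, hd⟩
  cases u with
  | outSt a ℓ p =>
    simp only [HopShortcut.scOutScan]
    split_ifs with h₁ h₂ h₂
    · exact ⟨hs, hd.relax (h.outSt_parent hus)
        (hux.trans_neg (hs.inv.admits_outSt_rev (hs.mem (h.ext.V hus))))⟩
    · exact ⟨hs, hd⟩
    · exact ⟨h.addEdgeOut hs (h.ext.V hus) hux, hd⟩
    · exact ⟨hs, hd⟩
  | _ => exact hother _ rfl

/-- Admissibility does not depend on the cut-off index: any gadget vertex of `v` and any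
in-neighbour of `v` would do. The guard on `ℓ` ensures that the gadget vertex exists. -/
theorem HubAt.scInHeavy (h : HubAt G θ s₀ b t r δ) {c : State ι × (Vert ι → WithTop ℝ)}
    (hs : Good G θ b c.1) (hd : DistIn G θ s₀ r c.2) {v : Vert ι} {x : ℝ} {l : List (Vert ι)}
    (hx : Admits G θ v (neg r) x) (hl : ∀ u ∈ l, (u, v) ∈ s₀.E)
    (hg : ∀ ℓ < Nat.clog 2 l.length, inSt t ℓ v ∈ b.V) :
    Good G θ b (scInHeavy t r δ l v x c).1 ∧ DistIn G θ s₀ r (scInHeavy t r δ l v x c).2 := by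
  unfold HopShortcut.scInHeavy
  refine List.foldlRecOn
    (motive := fun c : State ι × (Vert ι → WithTop ℝ) => Good G θ b c.1 ∧ DistIn G θ s₀ r c.2)
    _ _ ⟨?_, hd⟩ fun c' hc' u hu =>
      h.scInScan hc'.1 hc'.2 hx (hl u (List.mem_of_mem_drop hu))
  dsimp only
  split_ifs with hℓ
  · exact h.addEdgeIn hs (hg _ hℓ) ((hs.inv.admits_inSt (hs.mem (hg _ hℓ))).trans hx)
  · exact hs

theorem HubAt.scOutHeavy (h : HubAt G θ s₀ b t r δ) {c : State ι × (Vert ι → WithTop ℝ)}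
    (hs : Good G θ b c.1) (hd : DistOut G θ s₀ r c.2) {v : Vert ι} {x : ℝ} {l : List (Vert ι)}
    (hx : Admits G θ (neg r) v x) (hl : ∀ u ∈ l, (v, u) ∈ s₀.E)
    (hg : ∀ ℓ < Nat.clog 2 l.length, outSt t ℓ v ∈ b.V) :
    Good G θ b (scOutHeavy t r δ l v x c).1 ∧ DistOut G θ s₀ r (scOutHeavy t r δ l v x c).2 := by
  unfold HopShortcut.scOutHeavy
  refine List.foldlRecOn
    (motive := fun c : State ι × (Vert ι → WithTop ℝ) => Good G θ b c.1 ∧ DistOut G θ s₀ r c.2)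
    _ _ ⟨?_, hd⟩ fun c' hc' u hu =>
      h.scOutScan hc'.1 hc'.2 hx (hl u (List.mem_of_mem_drop hu))
  dsimp only
  split_ifs with hℓ
  · exact h.addEdgeOut hs (hg _ hℓ) (hx.trans (hs.inv.admits_outSt (hs.mem (hg _ hℓ))))
  · exact hs

/-- The loop preserves `Good` together with `DistIn`. Since `DistIn` confines finite tentative
distances to vertices of `s₀`, the vertices processed are those for which lists and gadgets were
prepared. -/
theorem HubAt.shortcutIn (h : HubAt G θ s₀ b t r δ) {L : Vert ι → List (Vert ι)}
    {d : Vert ι → WithTop ℝ} {s s' : State ι} (hs : Good G θ b s) (hd : DistIn G θ s₀ r d)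
    (hL : ∀ v, s₀.Heavy v → ∀ u ∈ L v, (u, v) ∈ s₀.E)
    (hg : ∀ v, s₀.Heavy v → ∀ ℓ < Nat.clog 2 (L v).length, inSt t ℓ v ∈ b.V)
    (hr : ShortcutIn t r δ s₀.listIn L d s s') : Good G θ b s' := by
  obtain ⟨d', hr⟩ := hr
  refine (hr.induct
    (P := fun c : State ι × (Vert ι → WithTop ℝ) => Good G θ b c.1 ∧ DistIn G θ s₀ r c.2)
    (fun ℓ _ c c' hc hcc' => hcc'.induct (P := fun c : State ι × (Vert ι → WithTop ℝ) =>
      Good G θ b c.1 ∧ DistIn G θ s₀ r c.2) (fun v _ c c' hc hp => ?_) hc) ⟨hs, hd⟩).1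
  obtain ⟨hc, hd⟩ := hc
  obtain ⟨x, hx, hp⟩ := hp
  obtain ⟨hv, hvx⟩ := hd v x hx
  rcases hp with ⟨p, ⟨a, ℓ, rfl⟩, rfl⟩ | ⟨-, hlight, rfl⟩ | ⟨-, -, hc', hloop⟩
  · exact ⟨hc, hd.relax (h.inSt_parent hv)
      ((hc.inv.admits_inSt_rev (hc.mem (h.ext.V hv))).neg_trans hvx)⟩
  -- Extensions do not change the light set, so `v` was already heavy when the lists were frozen.
  · rw [hc.ext.light, h.ext.light] at hlight
    exact h.scInHeavy (c := (HopShortcut.scInOut _ r δ v x c.1, c.2)) (h.scInOut hc hv hvx) hd hvx (hL v ⟨hv, hlight⟩) (hg v ⟨hv, hlight⟩)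
  · refine ⟨hloop.induct (P := Good G θ b) ?_ (h.scInOut hc hv hvx), hc' ▸ hd⟩
    rintro u hu σ _ hσ rfl
    split_ifs
    · exact h.addEdgeIn hσ (h.ext.V (h.mem_of_edge hu.1).1) ((hσ.edge (h.ext.E hu.1)).trans hvx)
    · exact hσ

theorem HubAt.shortcutOut (h : HubAt G θ s₀ b t r δ) {L : Vert ι → List (Vert ι)}
    {d : Vert ι → WithTop ℝ} {s s' : State ι} (hs : Good G θ b s) (hd : DistOut G θ s₀ r d)
    (hL : ∀ v, s₀.Heavy v → ∀ u ∈ L v, (v, u) ∈ s₀.E)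
    (hg : ∀ v, s₀.Heavy v → ∀ ℓ < Nat.clog 2 (L v).length, outSt t ℓ v ∈ b.V)
    (hr : ShortcutOut t r δ s₀.listOut L d s s') : Good G θ b s' := by
  obtain ⟨d', hr⟩ := hr
  refine (hr.induct
    (P := fun c : State ι × (Vert ι → WithTop ℝ) => Good G θ b c.1 ∧ DistOut G θ s₀ r c.2)
    (fun ℓ _ c c' hc hcc' => hcc'.induct (P := fun c : State ι × (Vert ι → WithTop ℝ) =>
      Good G θ b c.1 ∧ DistOut G θ s₀ r c.2) (fun v _ c c' hc hp => ?_) hc) ⟨hs, hd⟩).1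
  obtain ⟨hc, hd⟩ := hc
  obtain ⟨x, hx, hp⟩ := hp
  obtain ⟨hv, hvx⟩ := hd v x hx
  rcases hp with ⟨p, ⟨a, ℓ, rfl⟩, rfl⟩ | ⟨-, hlight, rfl⟩ | ⟨-, -, hc', hloop⟩
  · exact ⟨hc, hd.relax (h.outSt_parent hv)
      (hvx.trans_neg (hc.inv.admits_outSt_rev (hc.mem (h.ext.V hv))))⟩
  · rw [hc.ext.light, h.ext.light] at hlight
    exact h.scOutHeavy (c := (HopShortcut.scOutIn _ r δ v x c.1, c.2)) (h.scOutIn hc hv hvx) hd hvx (hL v ⟨hv, hlight⟩) (hg v ⟨hv, hlight⟩)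
  · refine ⟨hloop.induct (P := Good G θ b) ?_ (h.scOutIn hc hv hvx), hc' ▸ hd⟩
    rintro u hu σ _ hσ rfl
    split_ifs
    · exact h.addEdgeOut hσ (h.ext.V (h.mem_of_edge hu.1).2) (hvx.trans (hσ.edge (h.ext.E hu.1)))
    · exact hσ

theorem HubAt.shortcutAt {Δ : ι → ℝ} (h : HubAt G θ s₀ b t r (Δ r))
    {Lin Lout : Vert ι → List (Vert ι)} {din dout : ι → Vert ι → WithTop ℝ} {s s' : State ι}
    (hs : Good G θ b s) (hdin : DistIn G θ s₀ r (din r)) (hdout : DistOut G θ s₀ r (dout r))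
    (hLin : ∀ v, s₀.Heavy v → ∀ u ∈ Lin v, (u, v) ∈ s₀.E)
    (hgin : ∀ v, s₀.Heavy v → ∀ ℓ < Nat.clog 2 (Lin v).length, inSt t ℓ v ∈ b.V)
    (hLout : ∀ v, s₀.Heavy v → ∀ u ∈ Lout v, (v, u) ∈ s₀.E)
    (hgout : ∀ v, s₀.Heavy v → ∀ ℓ < Nat.clog 2 (Lout v).length, outSt t ℓ v ∈ b.V)
    (hr : ShortcutAt t Δ s₀.listIn s₀.listOut Lin Lout din dout r s s') : Good G θ b s' := by
  obtain ⟨s₁, s₂, s₃, hr₁, hr₂, hr₃, hr₄⟩ := hr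
  have h₁ := h.shortcutIn hs hdin hLin hgin hr₁
  have h₂ := h.shortcutOut h₁ hdout hLout hgout hr₂
  have h₃ : Good G θ b s₃ := by
    split_ifs at hr₃
    · refine hr₃.induct (P := Good G θ b) ?_ h₂
      rintro v hv σ _ hσ rfl
      exact h.addEdgeIn hσ (h.ext.V (h.mem_of_edge hv.1).1) (hσ.edge (h.ext.E hv.1))
    · exact hr₃ ▸ h₂
  split_ifs at hr₄
  · refine hr₄.induct (P := Good G θ b) ?_ h₃
    rintro v hv σ _ hσ rfl
    refine hσ.addEdgeOut h.mem (h.ext.V (h.mem_of_edge hv.1).2) ?_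
    -- The walk behind the new edge is `r̃_t → r → r̄ → v`.
    exact ((h.from_hub.trans (hσ.inv.edge _ _ (hσ.inv.bar_link r).1)).trans
      (hσ.edge (h.ext.E hv.1))).mono (by linarith)
  · exact hr₄ ▸ h₃

end Shortcuts

/-! ### Reweighting, redirection, and one whole iteration. -/

section Iteration

variable {G : WGraph ι} {θ : Vert ι → ℝ} {s : State ι}

theorem Admits.reweight {x y : Vert ι} {W : ℝ} (h : Admits G θ x y W) (φ : Vert ι → ℝ) :
    Admits G (fun x => θ x + φ x) x y (W + φ x - φ y) :=
  le_trans h (EReal.coe_le_coe_iff.2 (by linarith))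

theorem OutLink.reweight {p x : Vert ι} (h : OutLink θ s p x) (φ : Vert ι → ℝ) :
    OutLink (fun x => θ x + φ x) (s.reweight φ) p x := by
  rcases h with ⟨h₁, h₂⟩ | ⟨r, rfl, h₁, h₂⟩
  · exact .inl ⟨h₁, by simp only [State.reweight]; linarith⟩
  · exact .inr ⟨r, rfl, h₁, by simp only [State.reweight]; linarith⟩

theorem Inv.reweight (h : Inv G θ s) (φ : Vert ι → ℝ) :
    Inv G (fun x => θ x + φ x) (s.reweight φ) where
  neg_mem := h.neg_mem
  bar_mem := h.bar_mem
  pot_eq r := by simp only [State.reweight, h.pot_eq]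
  base x y hxy := by
    obtain ⟨h₁, h₂⟩ := h.base x y hxy
    exact ⟨h₁, by simp only [State.reweight]; linarith⟩
  bar_link r := by
    obtain ⟨h₁, h₂⟩ := h.bar_link r
    exact ⟨h₁, by simp only [State.reweight]; linarith⟩
  inSt_link t ℓ p hx := by
    obtain ⟨h₁, h₂, h₃⟩ := h.inSt_link t ℓ p hx
    exact ⟨h₁, h₂, by simp only [State.reweight]; linarith⟩
  outSt_link t ℓ p hx := by
    obtain ⟨h₁, h₂⟩ := h.outSt_link t ℓ p hx
    exact ⟨h₁, h₂.reweight φ⟩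
  nSt_link t r hx := by
    obtain ⟨h₁, h₂, h₃⟩ := h.nSt_link t r hx
    exact ⟨h₁, by simp only [State.reweight]; linarith, h₃.reweight φ⟩
  edge_mem := h.edge_mem
  edge x y hxy := (h.edge x y hxy).reweight φ
  defIn := by
    rintro x y W ⟨⟨u, v, c⟩, he, heq⟩
    cases heq
    obtain ⟨h₁, h₂, h₃⟩ := h.defIn _ _ _ he
    exact ⟨h₁, h₂, h₃.reweight φ⟩
  defOut := by
    rintro x y W ⟨⟨u, v, c⟩, he, heq⟩
    cases heq
    obtain ⟨h₁, h₂, h₃⟩ := h.defOut _ _ _ he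
    exact ⟨h₁, h₂, h₃.reweight φ⟩

theorem redirect_w_le {r : ι} {x y : Vert ι} (hxy : (x, y) ∈ s.E) :
    (s.redirect r).w x y ≤ s.w x y := by
  simp only [State.redirect]
  split_ifs with h₁ h₂
  · obtain ⟨rfl, -⟩ := h₁
    exact min_le_left _ _
  · obtain ⟨rfl, -⟩ := h₁
    exact absurd hxy h₂
  · exact le_rfl

theorem redirect_w_bar_le {r : ι} {y : Vert ι} (hy : y ≠ bar r) (hry : (neg r, y) ∈ s.E) :
    (s.redirect r).w (bar r) y ≤ s.w (neg r) y - s.w (neg r) (bar r) := by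
  simp only [State.redirect]
  rw [if_pos ⟨rfl, hy, hry⟩]
  split_ifs
  · exact min_le_right _ _
  · exact le_rfl

/-- A direct link from `r` turns into the alternative via `r̄`, of no larger weight; this is why
`OutLink` is a disjunction. The target must not be a barred vertex, since an edge `(r, r̄)` is not
redirected. -/
theorem OutLink.redirect {p x : Vert ι} (h : OutLink θ s p x) (hx : ∀ r, x ≠ bar r)
    (hb : ∀ r, (neg r, bar r) ∈ s.E) (r : ι) : OutLink θ (s.redirect r) p x := by
  rcases h with ⟨h₁, h₂⟩ | ⟨r', rfl, h₁, h₂⟩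
  · by_cases hp : p = neg r
    · subst hp
      refine .inr ⟨r, rfl, .inr ⟨rfl, hx r, h₁⟩, ?_⟩
      have i₁ := redirect_w_bar_le (hx r) h₁
      have i₂ := redirect_w_le (r := r) (hb r)
      linarith
    · exact .inl ⟨.inl ⟨h₁, fun e => absurd e hp⟩, (redirect_w_le h₁).trans h₂⟩
  · exact .inr ⟨r', rfl, .inl ⟨h₁, fun e => by cases e⟩,
      (add_le_add (redirect_w_le (hb r')) (redirect_w_le h₁)).trans h₂⟩

/-- A redirected edge is the reversed link `r̄ → r` followed by the old edge. Edges of `G` are not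
lost, because in a well-behaved graph only `(r, r̄)` leaves `r`. -/
theorem Inv.redirect (h : Inv G θ s) (hG : G.WellBehaved) (r : ι) :
    Inv G θ (s.redirect r) where
  neg_mem := h.neg_mem
  bar_mem := h.bar_mem
  pot_eq := h.pot_eq
  base x y hxy := by
    obtain ⟨h₁, h₂⟩ := h.base x y hxy
    refine ⟨.inl ⟨h₁, ?_⟩, (redirect_w_le h₁).trans h₂⟩
    rintro rfl
    exact hG.neg_out r y hxy
  bar_link r' := by
    obtain ⟨h₁, h₂⟩ := h.bar_link r'
    refine ⟨.inl ⟨h₁, ?_⟩, (redirect_w_le h₁).trans h₂⟩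
    intro e
    cases e
    rfl
  inSt_link t ℓ p hx := by
    obtain ⟨h₁, h₂, h₃⟩ := h.inSt_link t ℓ p hx
    exact ⟨h₁, .inl ⟨h₂, fun e => by cases e⟩, (redirect_w_le h₂).trans h₃⟩
  outSt_link t ℓ p hx := by
    obtain ⟨h₁, h₂⟩ := h.outSt_link t ℓ p hx
    exact ⟨h₁, h₂.redirect (by simp) (fun r => (h.bar_link r).1) r⟩
  nSt_link t r' hx := by
    obtain ⟨h₁, h₂, h₃⟩ := h.nSt_link t r' hx
    exact ⟨.inl ⟨h₁, fun e => by cases e⟩, (redirect_w_le h₁).trans h₂,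
      h₃.redirect (by simp) (fun r => (h.bar_link r).1) r⟩
  edge_mem := by
    rintro x y (⟨hxy, -⟩ | ⟨hx, -, hy⟩)
    · exact h.edge_mem x y hxy
    · dsimp only at hx hy
      subst hx
      exact ⟨h.bar_mem r, (h.edge_mem _ _ hy).2⟩
  edge x y hxy := by
    have hnew : (neg r, y) ∈ s.E → Admits G θ (bar r) y (s.w (neg r) y - s.w (neg r) (bar r)) :=
      fun hy => (h.admits_bar r).neg_trans (h.edge _ _ hy)
    simp only [State.redirect]
    split_ifs with h₁ h₂
    · obtain ⟨rfl, -, hy⟩ := h₁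
      rcases min_choice (s.w (bar r) y) (s.w (neg r) y - s.w (neg r) (bar r)) with e | e <;> rw [e]
      · exact h.edge _ _ h₂
      · exact hnew hy
    · obtain ⟨rfl, -, hy⟩ := h₁
      exact hnew hy
    · rcases hxy with ⟨hxy, -⟩ | hxy
      · exact h.edge x y hxy
      · exact absurd hxy h₁
  defIn := h.defIn
  defOut := h.defOut

/-- `Inv.reweight` applies to every potential, so the infima defining this one need not be
evaluated. -/
theorem Inv.restore (h : Inv G θ s) (hG : G.WellBehaved) (r : ι) :
    ∃ θ', Inv G θ' (s.restore r) :=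
  ⟨_, (h.redirect hG r).reweight _⟩

theorem Inv.classify (h : Inv G θ s) (t : ℕ) (lam : ℝ) : Inv G θ (s.classify t lam) :=
  ⟨h.neg_mem, h.bar_mem, h.pot_eq, h.base, h.bar_link, h.inSt_link, h.outSt_link, h.nSt_link,
    h.edge_mem, h.edge, h.defIn, h.defOut⟩

/-- Weights only fall under extension, so an earlier weight dominates an admissible one. Distances
measured earlier thus remain usable with a later `θ`. -/
theorem Inv.admits_edge_of_ext {s₀ : State ι} (h : Inv G θ s) (he : Ext s₀ s) (x y : Vert ι)
    (hxy : (x, y) ∈ s₀.E) : Admits G θ x y (s₀.w x y) :=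
  (h.edge _ _ (he.E hxy)).mono (he.w _ _ hxy)

theorem restrictTop_eq_coe {U : Set (Vert ι)} {f : Vert ι → ℝ} {v : Vert ι} {x : ℝ}
    (h : restrictTop U f v = (x : WithTop ℝ)) : v ∈ U ∧ f v = x := by
  unfold restrictTop at h
  split_ifs at h with hv
  · exact ⟨hv, WithTop.coe_inj.1 h⟩
  · exact absurd h WithTop.top_ne_coe

/-- An iteration preserves the invariant. -/
theorem Shortcut.inv {t : ℕ} {s' : State ι} (hG : G.WellBehaved) (hr : Shortcut (t + 1) s s')
    (hs : ∃ θ, Inv G θ s) (hlev : ∀ x ∈ s.V, x.level ≤ t) :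
    (∃ θ, Inv G θ s') ∧ ∀ x ∈ s'.V, x.level ≤ t + 1 := by
  obtain ⟨φ, Δ, lam, dIn, dOut, Lin, Lout, s₁, s₂, s₃, s₄, s₅, s₆, s₇, s₈, s₉, s₁₀, _, -, rfl,
    hdefIn, hdefOut, hdIn, hdOut, hml, hmr, hsIn, hgIn, hsOut, hgOut, hhub, hsc, hres, rfl⟩ := hr
  obtain ⟨θ, h⟩ := hs
  replace h := h.reweight φ
  set s₁ := s.reweight φ with hs₁
  obtain ⟨θ, h⟩ : ∃ θ, Inv G θ s₁ := ⟨_, h⟩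
  have g₂ : Good G θ s₁ s₂ := by
    refine hdefIn.induct (P := Good G θ s₁) ?_ (Good.refl h)
    rintro ⟨u, v, W⟩ he σ _ hσ rfl
    obtain ⟨hu, hv, hW⟩ := h.defIn _ _ _ he
    split_ifs
    · exact hσ.addEdgeIn hu hv hW
    · exact hσ
  have g₃ : Good G θ s₁ s₃ := by
    refine hdefOut.induct (P := Good G θ s₁) ?_ g₂
    rintro ⟨u, v, W⟩ he σ _ hσ rfl
    obtain ⟨hu, hv, hW⟩ := h.defOut _ _ _ he
    split_ifs
    · exact hσ.addEdgeOut hu hv hW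
    · exact hσ
  have h₃ := g₃.inv
  have hlev₃ : ∀ x ∈ s₃.V, x.level ≤ t := by
    rw [g₃.V]
    exact hlev
  -- The distances are frozen in `s₃`, but `θ'` belongs to a later state with more vertices.
  have hdi : ∀ {θ' σ}, Inv G θ' σ → Ext s₃ σ → ∀ r, ∀ v ∈ setUIn s₃ Δ r,
      Admits G θ' v (neg r) (dIn r v) := fun hσ he r v hv =>
    .of_hopDist (hσ.admits_edge_of_ext he) (hdIn r v hv)
  have hdo : ∀ {θ' σ}, Inv G θ' σ → Ext s₃ σ → ∀ r, ∀ v ∈ setUOut s₃ Δ r,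
      Admits G θ' (neg r) v (dOut r v) := fun hσ he r v hv =>
    .of_hopDist (hσ.admits_edge_of_ext he) (hdOut r v hv)
  have g₄ : Good G θ s₃ s₄ := by
    refine hml.induct (P := Good G θ s₃) ?_ (Good.refl h₃)
    rintro ⟨r, u⟩ hu σ _ hσ rfl
    exact hσ.addEdge (h₃.neg_mem u) (h₃.bar_mem r)
      (((hσ.inv.edge _ _ (hσ.inv.bar_link u).1).trans (hdi h₃ (Ext.refl _) r _ hu)).trans
        (hσ.inv.edge _ _ (hσ.inv.bar_link r).1))
  have g₅ : Good G θ s₃ s₅ := by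
    refine hmr.induct (P := Good G θ s₃) ?_ g₄
    rintro ⟨r, u⟩ hu σ _ hσ rfl
    exact hσ.addEdge (h₃.neg_mem r) (h₃.bar_mem u)
      ((hdo h₃ (Ext.refl _) r _ hu).trans (hσ.inv.edge _ _ (hσ.inv.bar_link u).1))
  have hlev₅ : ∀ x ∈ s₅.V, x.level ≤ t := by
    rw [g₅.V]
    exact hlev₃
  have hLin : ∀ v, s₃.Heavy v → ∀ u ∈ Lin v, (u, v) ∈ s₃.E :=
    fun v hv u hu => (((hsIn v hv).2.1 u).1 hu).1
  have hLout : ∀ v, s₃.Heavy v → ∀ u ∈ Lout v, (v, u) ∈ s₃.E :=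
    fun v hv u hu => (((hsOut v hv).2.1 u).1 hu).1
  -- Freshness comes from the level: all earlier vertices have level at most `t`.
  have hnew : ∀ {σ : State ι} {x : Vert ι}, (∀ y ∈ σ.V, y.level ≤ t) → x.level = t + 1 →
      x ∉ σ.V := fun hσ hx hm => by
    have := hσ _ hm
    omega
  obtain ⟨i₆, e₆, n₆, q₆⟩ : (∃ θ, Inv G θ s₆) ∧ Ext s₅ s₆ ∧
      (∀ x ∈ s₆.V, x ∈ s₅.V ∨ ∃ ℓ v, x = inSt (t + 1) ℓ v) ∧
      ∀ v, s₃.Heavy v → ∀ ℓ < Nat.clog 2 (Lin v).length, inSt (t + 1) ℓ v ∈ s₆.V := by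
    obtain ⟨l, hl, hmem, hrun⟩ := hgIn
    obtain ⟨j₁, j₂, j₃, j₄⟩ := hrun.grow (G := G) (b₀ := s₃)
      (X := fun v => {x | ∃ ℓ < Nat.clog 2 (Lin v).length, x = inSt (t + 1) ℓ v})
      (Q := fun v σ => ∀ ℓ < Nat.clog 2 (Lin v).length, inSt (t + 1) ℓ v ∈ σ.V)
      (by
        rintro v hv σ _ ⟨θ', hθ'⟩ he hd rfl
        have hv := (hmem v).1 hv
        obtain ⟨k₁, k₂, k₃⟩ := addInGadget_grow ⟨θ', hθ'⟩ (he.V hv.1)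
          (fun ℓ hℓ hm => Set.disjoint_left.1 hd ⟨ℓ, hℓ, rfl⟩ hm)
          (fun u hu => he.E (hLin v hv u hu))
        exact ⟨k₁, k₂, k₃, fun ℓ hℓ => k₃ ▸ .inr ⟨ℓ, hℓ, rfl⟩⟩)
      (fun v σ σ' he hm ℓ hℓ => he.V (hm ℓ hℓ))
      (hl.imp fun hne => Set.disjoint_left.2 (by
        rintro _ ⟨ℓ, -, rfl⟩ ⟨ℓ', -, he⟩
        cases he
        exact hne rfl))
      ⟨θ, g₅.inv⟩ g₅.ext
      (fun v _ => Set.disjoint_left.2 (by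
        rintro _ ⟨ℓ, -, rfl⟩
        exact hnew hlev₅ rfl))
    refine ⟨j₁, j₂, fun x hx => (j₃ x hx).imp id ?_, fun v hv => j₄ v ((hmem v).2 hv)⟩
    rintro ⟨v, -, ℓ, -, rfl⟩
    exact ⟨ℓ, v, rfl⟩
  have hm₆ : ∀ ℓ v, outSt (t + 1) ℓ v ∉ s₆.V := fun ℓ v hm => by
    rcases n₆ _ hm with hm | ⟨_, _, he⟩
    · exact hnew hlev₅ rfl hm
    · cases he
  have e₃₆ := g₅.ext.trans e₆
  obtain ⟨i₇, e₇, n₇, q₇⟩ : (∃ θ, Inv G θ s₇) ∧ Ext s₆ s₇ ∧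
      (∀ x ∈ s₇.V, x ∈ s₆.V ∨ ∃ ℓ v, x = outSt (t + 1) ℓ v) ∧
      ∀ v, s₃.Heavy v → ∀ ℓ < Nat.clog 2 (Lout v).length, outSt (t + 1) ℓ v ∈ s₇.V := by
    obtain ⟨l, hl, hmem, hrun⟩ := hgOut
    obtain ⟨j₁, j₂, j₃, j₄⟩ := hrun.grow (G := G) (b₀ := s₃)
      (X := fun v => {x | ∃ ℓ < Nat.clog 2 (Lout v).length, x = outSt (t + 1) ℓ v})
      (Q := fun v σ => ∀ ℓ < Nat.clog 2 (Lout v).length, outSt (t + 1) ℓ v ∈ σ.V)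
      (by
        rintro v hv σ _ ⟨θ', hθ'⟩ he hd rfl
        have hv := (hmem v).1 hv
        obtain ⟨k₁, k₂, k₃⟩ := addOutGadget_grow ⟨θ', hθ'⟩ (he.V hv.1)
          (fun ℓ hℓ hm => Set.disjoint_left.1 hd ⟨ℓ, hℓ, rfl⟩ hm)
          (fun u hu => he.E (hLout v hv u hu))
        exact ⟨k₁, k₂, k₃, fun ℓ hℓ => k₃ ▸ .inr ⟨ℓ, hℓ, rfl⟩⟩)
      (fun v σ σ' he hm ℓ hℓ => he.V (hm ℓ hℓ))
      (hl.imp fun hne => Set.disjoint_left.2 (by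
        rintro _ ⟨ℓ, -, rfl⟩ ⟨ℓ', -, he⟩
        cases he
        exact hne rfl))
      i₆ e₃₆
      (fun v _ => Set.disjoint_left.2 (by
        rintro _ ⟨ℓ, -, rfl⟩
        exact hm₆ ℓ v))
    refine ⟨j₁, j₂, fun x hx => (j₃ x hx).imp id ?_, fun v hv => j₄ v ((hmem v).2 hv)⟩
    rintro ⟨v, -, ℓ, -, rfl⟩
    exact ⟨ℓ, v, rfl⟩
  have hm₇ : ∀ r, nSt (t + 1) r ∉ s₇.V := fun r hm => by
    rcases n₇ _ hm with hm | ⟨_, _, he⟩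
    · rcases n₆ _ hm with hm | ⟨_, _, he⟩
      · exact hnew hlev₅ rfl hm
      · cases he
    · cases he
  have e₃₇ := e₃₆.trans e₇
  obtain ⟨⟨θ₈, i₈⟩, e₈, n₈, q₈⟩ : (∃ θ, Inv G θ s₈) ∧ Ext s₇ s₈ ∧
      (∀ x ∈ s₈.V, x ∈ s₇.V ∨ ∃ r, x = nSt (t + 1) r) ∧
      ∀ r, ((nSt (t + 1) r, neg r) ∈ s₈.E ∧ s₈.w (nSt (t + 1) r) (neg r) ≤ Δ r) ∧
        (neg r, nSt (t + 1) r) ∈ s₈.E ∧ s₈.w (neg r) (nSt (t + 1) r) ≤ -Δ r := by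
    obtain ⟨l, hl, hmem, hrun⟩ := hhub
    obtain ⟨j₁, j₂, j₃, j₄⟩ := hrun.grow (G := G) (b₀ := s₃) (X := fun r => {nSt (t + 1) r})
      (Q := fun r σ => ((nSt (t + 1) r, neg r) ∈ σ.E ∧ σ.w (nSt (t + 1) r) (neg r) ≤ Δ r) ∧
        (neg r, nSt (t + 1) r) ∈ σ.E ∧ σ.w (neg r) (nSt (t + 1) r) ≤ -Δ r)
      (by
        rintro r - σ _ ⟨θ', hθ'⟩ he hd rfl
        refine ⟨hθ'.addNSteiner (Set.disjoint_singleton_left.1 hd),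
          ((Ext.addVertex _ _).trans (Ext.addEdge _ _ _ _)).trans (Ext.addEdge _ _ _ _),
          Set.union_singleton.symm, ⟨.inr (.inl rfl), ?_⟩, .inl rfl, addEdge_w_self_le _ _ _ _⟩
        exact ((Ext.addEdge _ _ _ _).w _ _ (Set.mem_insert _ _)).trans
          (addEdge_w_self_le _ _ _ _))
      (fun r σ σ' he hm => ⟨⟨he.E hm.1.1, (he.w _ _ hm.1.1).trans hm.1.2⟩, he.E hm.2.1,
        (he.w _ _ hm.2.1).trans hm.2.2⟩)
      (hl.imp fun hne => by simpa using hne) i₇ e₃₇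
      (fun r _ => Set.disjoint_singleton_left.2 (hm₇ r))
    refine ⟨j₁, j₂, fun x hx => (j₃ x hx).imp id ?_, fun r => j₄ r ((hmem r).2 trivial)⟩
    rintro ⟨r, -, rfl⟩
    exact ⟨r, rfl⟩
  have e₃₈ := e₃₇.trans e₈
  have g₉ : Good G θ₈ s₈ s₉ := by
    refine hsc.induct (P := Good G θ₈ s₈) (fun r _ σ σ' hσ hstep => ?_) (Good.refl i₈)
    obtain ⟨⟨q₁, q₂⟩, q₃, q₄⟩ := q₈ r
    -- The hub edges weigh at most `Δ r` and `-Δ r` and are admissible, hence so are these two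
    -- values themselves.
    have hub : HubAt G θ₈ s₃ s₈ (t + 1) r (Δ r) :=
      ⟨⟨θ, h₃⟩, e₃₈, (i₈.edge_mem _ _ q₁).1, (i₈.edge _ _ q₃).mono q₄, (i₈.edge _ _ q₁).mono q₂⟩
    refine hub.shortcutAt hσ ?_ ?_ hLin (fun v hv ℓ hℓ => e₈.V (e₇.V (q₆ v hv ℓ hℓ))) hLout
      (fun v hv ℓ hℓ => e₈.V (q₇ v hv ℓ hℓ)) hstep
    · intro v x hx
      obtain ⟨hv, rfl⟩ := restrictTop_eq_coe hx
      exact ⟨hv.1, hdi i₈ e₃₈ r v hv⟩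
    · intro v x hx
      obtain ⟨hv, rfl⟩ := restrictTop_eq_coe hx
      exact ⟨hv.1, hdo i₈ e₃₈ r v hv⟩
  have hlev₉ : ∀ x ∈ s₉.V, x.level ≤ t + 1 := by
    intro x hx
    rw [g₉.V] at hx
    rcases n₈ x hx with hx | ⟨r, rfl⟩
    · rcases n₇ x hx with hx | ⟨ℓ, v, rfl⟩
      · rcases n₆ x hx with hx | ⟨ℓ, v, rfl⟩
        · exact (hlev₅ x hx).trans (Nat.le_succ t)
        · exact le_rfl
      · exact le_rfl
    · exact le_rfl
  obtain ⟨⟨θ₁₀, i₁₀⟩, hV₁₀⟩ : (∃ θ, Inv G θ s₁₀) ∧ s₁₀.V = s₉.V := by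
    refine hres.induct (P := fun σ => (∃ θ, Inv G θ σ) ∧ σ.V = s₉.V) ?_ ⟨⟨θ₈, g₉.inv⟩, rfl⟩
    rintro r - σ _ ⟨⟨θ', hθ'⟩, hV⟩ rfl
    exact ⟨hθ'.restore hG r, hV⟩
  refine ⟨⟨θ₁₀, i₁₀.classify _ _⟩, ?_⟩
  change ∀ x ∈ s₁₀.V, _
  rw [hV₁₀]
  exact hlev₉

end Iteration

/-! ### Initial state, the function `ψ`, and the conclusion. -/

section Main

variable {G : WGraph ι} {θ : Vert ι → ℝ} {s : State ι}

/-- The potential under which the edges of a well-behaved graph are admissible. -/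
def initPotential (G : WGraph ι) : Vert ι → ℝ
  | bar r => -G.w (neg r) (bar r)
  | _ => 0

theorem Inv.init (hG : G.WellBehaved) : Inv G (initPotential G) (State.init G) := by
  have hV : ∀ x ∈ G.V, (∃ r, x = neg r) ∨ ∃ r, x = bar r := by
    intro x hx
    rw [hG.verts] at hx
    exact hx.imp (fun ⟨r, h⟩ => ⟨r, h.symm⟩) fun ⟨r, h⟩ => ⟨r, h.symm⟩
  refine ⟨fun r => ?_, fun r => ?_, fun r => rfl, fun x y hxy => ⟨hxy, ?_⟩,
    fun r => ⟨hG.neg_edge r, ?_⟩, fun t ℓ p hx => ?_, fun t ℓ p hx => ?_, fun t r hx => ?_,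
    hG.edge_mem, fun x y hxy => ?_, fun _ _ _ h => h.elim, fun _ _ _ h => h.elim⟩
  · change _ ∈ G.V
    rw [hG.verts]
    exact .inl ⟨r, rfl⟩
  · change _ ∈ G.V
    rw [hG.verts]
    exact .inr ⟨r, rfl⟩
  · simp [State.init]
  · simp [State.init, initPotential]
  · rcases hV _ hx with ⟨_, h⟩ | ⟨_, h⟩ <;> cases h
  · rcases hV _ hx with ⟨_, h⟩ | ⟨_, h⟩ <;> cases h
  · rcases hV _ hx with ⟨_, h⟩ | ⟨_, h⟩ <;> cases h
  · change (x, y) ∈ G.E at hxy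
    change Admits G _ x y (G.w x y)
    rcases hV _ (hG.edge_mem _ _ hxy).1 with ⟨r, rfl⟩ | ⟨r, rfl⟩
    · obtain rfl := hG.neg_out _ _ hxy
      exact .of_anc_eq rfl (by simp [initPotential])
    · rcases hV _ (hG.edge_mem _ _ hxy).2 with ⟨r', rfl⟩ | ⟨r', rfl⟩
      -- The ancestor of `r̄` is `r`, so the edge is preceded by `(r, r̄)`, whose weight is `-θ (bar
      -- r)`.
      · obtain ⟨_, h₁⟩ := WGraph.Walk.cons hxy (.nil _)
        obtain ⟨_, h₂⟩ := WGraph.Walk.cons (hG.neg_edge r) h₁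
        refine h₂.dist_le.trans (EReal.coe_le_coe_iff.2 ?_)
        simp only [initPotential]
        linarith
      · cases hG.bar_in _ _ hxy

/-- Every state of a run satisfies the invariant. -/
theorem exists_inv (hG : G.WellBehaved) {T : ℕ} {s : ℕ → State ι} (hinit : s 0 = State.init G)
    (hrun : ∀ t < T, Shortcut (t + 1) (s t) (s (t + 1))) :
    ∀ t ≤ T, ∃ θ, Inv G θ (s t) := by
  -- The bound on levels joins the induction because the next iteration needs its vertices to be
  -- new.
  have key : ∀ t ≤ T, (∃ θ, Inv G θ (s t)) ∧ ∀ x ∈ (s t).V, x.level ≤ t := by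
    intro t
    induction t with
    | zero =>
      intro _
      rw [hinit]
      refine ⟨⟨_, Inv.init hG⟩, fun x hx => ?_⟩
      change x ∈ G.V at hx
      rw [hG.verts] at hx
      rcases hx with ⟨r, rfl⟩ | ⟨r, rfl⟩ <;> exact le_rfl
    | succ t ih =>
      intro ht
      obtain ⟨h₁, h₂⟩ := ih (by omega)
      exact (hrun t (by omega)).inv hG h₁ h₂
  exact fun t ht => (key t ht).1

/-- The computed potential `ψ` agrees with `θ`, up to closed walks through the ancestor. -/
theorem Inv.admits_psi (h : Inv G θ s) (x : Vert ι) (hx : x ∈ s.V) :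
    Admits G θ x (neg x.anc) (s.psi x) ∧ Admits G θ (neg x.anc) x (-s.psi x) := by
  induction x with
  | neg r => exact ⟨.of_anc_eq rfl (by simp [State.psi, Vert.anc]),
      .of_anc_eq rfl (by simp [State.psi, Vert.anc])⟩
  | bar r =>
    simp only [State.psi, Vert.anc, neg_neg]
    exact ⟨h.admits_bar r, h.edge _ _ (h.bar_link r).1⟩
  | inSt t ℓ p ih =>
    obtain ⟨h₁, h₂⟩ := ih (h.inSt_link _ _ _ hx).1
    exact ⟨(h.admits_inSt hx).trans h₁,
      (h₂.trans (h.admits_inSt_rev hx)).mono (by simp only [State.psi]; linarith)⟩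
  | outSt t ℓ p ih =>
    obtain ⟨h₁, h₂⟩ := ih (h.outSt_link _ _ _ hx).1
    exact ⟨(h.admits_outSt_rev hx).trans h₁,
      (h₂.trans (h.admits_outSt hx)).mono (by simp only [State.psi]; linarith)⟩
  | nSt t r => exact ⟨h.admits_nSt hx, h.admits_nSt_rev hx⟩

theorem add_coe_le_of_le {a : EReal} {b c : ℝ} (h : a ≤ ((c - b : ℝ) : EReal)) :
    a + (b : EReal) ≤ (c : EReal) := by
  have := add_le_add_left h (b : EReal)
  rwa [← EReal.coe_add, sub_add_cancel] at this

/-- By `Inv.base` each edge of a walk in `G` survives with at most its reweighted weight, and the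
potentials telescope. -/
theorem Inv.dist_le_of_dist_le (h : Inv G θ s) {u v : ι} {c : ℝ}
    (hc : G.dist (neg u) (neg v) ≤ (c : EReal)) :
    s.dist (neg u) (neg v) ≤ ((c + s.pot (neg u) - s.pot (neg v) : ℝ) : EReal) := by
  have key : ∀ k x y a, G.Walk k x y a →
      ∃ k' a', s.Walk k' x y a' ∧ a' ≤ a + s.pot x - s.pot y := by
    intro k x y a hw
    have hcons : ∀ {x y z a}, (x, y) ∈ G.E →
        (∃ k' a', s.Walk k' y z a' ∧ a' ≤ a + s.pot y - s.pot z) →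
        ∃ k' a', s.Walk k' x z a' ∧ a' ≤ G.w x y + a + s.pot x - s.pot z := by
      rintro x y z a hxy ⟨k', a', hw, ha⟩
      obtain ⟨h₁, h₂⟩ := h.base _ _ hxy
      obtain ⟨k'', hw'⟩ := WGraph.Walk.cons h₁ hw
      exact ⟨k'', _, hw', by linarith⟩
    induction hw with
    | nil x => exact ⟨0, 0, .nil x, by simp⟩
    | consNeg hn _ ih => exact hcons hn.1 ih
    | consPos he _ _ ih => exact hcons he ih
  rw [WGraph.dist_le_coe_iff] at hc ⊢
  intro ε hε
  obtain ⟨k, a, hw, ha⟩ := hc ε hε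
  obtain ⟨k', a', hw', ha'⟩ := key _ _ _ _ hw
  exact ⟨k', a', hw', by linarith⟩

end Main

end HopShortcut

theorem mainTheorem3 {ι : Type*} [Finite ι] (G₀ : HopShortcut.WGraph ι) (hG₀ : G₀.WellBehaved)
    (T : ℕ) (s : ℕ → HopShortcut.State ι) (hinit : s 0 = HopShortcut.State.init G₀)
    (hrun : ∀ t < T, HopShortcut.Shortcut (t + 1) (s t) (s (t + 1))) :
    -- distances between negative vertices do not decrease (beyond the reweighting)
    (∀ i j, i ≤ j → j ≤ T → ∀ u v : ι,
      (s i).dist (.neg u) (.neg v) +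
          ((((s j).pot (.neg u) - (s i).pot (.neg u)) -
            ((s j).pot (.neg v) - (s i).pot (.neg v)) : ℝ) : EReal)
        ≤ (s j).dist (.neg u) (.neg v)) ∧
    -- the invariant, for the edges and the deferred edges
    (∀ t ≤ T, ∀ (x y : HopShortcut.Vert ι) (W : ℝ),
      ((x, y) ∈ (s t).E ∧ W = (s t).w x y ∨ (x, y, W) ∈ (s t).defIn ∨ (x, y, W) ∈ (s t).defOut) →
      G₀.dist (.neg x.anc) (.neg y.anc) +
          (((s t).pot (.neg x.anc) - (s t).pot (.neg y.anc) : ℝ) : EReal) +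
          (((s t).psi x - (s t).psi y : ℝ) : EReal)
        ≤ (W : EReal)) := by
  have hinv := HopShortcut.exists_inv hG₀ hinit hrun
  refine ⟨fun i j hij hj u v => ?_, fun t ht x y W hW => ?_⟩
  · obtain ⟨θi, hi⟩ := hinv i (hij.trans hj)
    obtain ⟨θj, hj⟩ := hinv j hj
    refine le_sInf ?_
    rintro _ ⟨c, ⟨k, hw⟩, rfl⟩
    -- A walk at time `j` is first projected to a distance bound in `G₀`, which is then lifted to
    -- the graph at time `i`.
    have h₁ := hi.dist_le_of_dist_le (HopShortcut.Admits.of_walk hj.edge hw)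
    refine HopShortcut.add_coe_le_of_le (h₁.trans (EReal.coe_le_coe_iff.2 ?_))
    simp only [HopShortcut.Vert.anc, hj.pot_eq]
    linarith
  · obtain ⟨θ, h⟩ := hinv t ht
    obtain ⟨hx, hy, hA⟩ : x ∈ (s t).V ∧ y ∈ (s t).V ∧ HopShortcut.Admits G₀ θ x y W := by
      rcases hW with ⟨hxy, rfl⟩ | hxy | hxy
      · exact ⟨(h.edge_mem _ _ hxy).1, (h.edge_mem _ _ hxy).2, h.edge _ _ hxy⟩
      · exact h.defIn _ _ _ hxy
      · exact h.defOut _ _ _ hxy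
    -- The composite runs from `a(x)` to `a(y)`, where `θ` equals the cumulative potential; its
    -- values at `x` and `y` cancel.
    have h₁ := (((h.admits_psi x hx).2.trans hA).trans (h.admits_psi y hy).1)
    rw [add_assoc, ← EReal.coe_add]
    refine HopShortcut.add_coe_le_of_le (le_trans h₁ (EReal.coe_le_coe_iff.2 ?_))
    rw [h.pot_eq, h.pot_eq]
    linarith
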